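/- Let $\mathcal C$ (calibration) and $\mathcal U$ (test) be disjoint index sets with $|\mathcal C| = n \ge 2$ and $|\mathcal U| = m$, and let $(X_i,Y_i)\in\mathbb R^d\times\mathbb R$, $i\in\mathcal C\cup\mathcal U$, be random. Let $\hat\mu,g:\mathbb R^d\to\mathbb R$ be fixed measurable functions, $R_i=|Y_i-\hat\mu(X_i)|$ and $T_i=g(X_i)$. Let $\hat\kappa$ be a measurable integer-valued function of all scores $(T_i)_{i\in\mathcal C\cup\mathcal U}$, and let $\mathrm T_{(\ell)}$ be the $\ell$-th smallest of $\{T_i\}_{i\in\mathcal U}$. Put $$\hat{\mathcal S}_u=\{j\in\mathcal U: T_j\le \mathrm T_{(\hat\kappa)}\},\qquad \hat{\mathcal S}_c^+=\{i\in\mathcal C: T_i\le \mathrm T_{(\hat\kappa+1)}\}.$$ For $\alpha\in(0,1)$ and $j\in\mathcal U$ let $\mathrm{PI}_j=\{y\in\mathbb R:|y-\hat\mu(X_j)|\le Q\}$, where $Q$ is the $\lceil(1-\alpha)(|\hat{\mathcal S}_c^+|+1)\rceil$-th smallest value of $\{R_i\}_{i\in\hat{\mathcal S}_c^+}$ (and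 $Q=+\infty$ if that rank exceeds $|\hat{\mathcal S}_c^+|$), and let $$\mathrm{FCR}=\mathbb E\left[\frac{|\{j\in\hat{\mathcal S}_u: Y_j\notin\mathrm{PI}_j\}|}{\max\{|\hat{\mathcal S}_u|,1\}}\right].$$ For $j\in\mathcal U$, $k\in\mathcal C$ and reals $t_u,t_c$, let $\hat\kappa^{j\gets t_u}$ be the value of $\hat\kappa$ after replacing $T_j$ by $t_u$, and $\hat\kappa^{(j,k)\gets(t_u,t_c)}$ its value after replacing $T_j$ by $t_u$ and $T_k$ by $t_c$. Assume: 1. The pairs $(R_i,T_i)$, $i\in\mathcal C\cup\mathcal U$, are independent and identically distributed, and the laws of $R_i$ and of $T_i$ have no atoms. 2. There are deterministic $t_u,t_c\in\mathbb R$, integers $I_u,I_c\ge0$ and $\gamma\in(0,1)$ such that almost surely: $\hat\kappa^{j\gets t_u}=\hat\kappa$ for all $j\in\hat{\mathcal S}_u$; $\hat\kappa\le\hat\kappa^{j\gets t_u}\le\hat\kappa+I_u$ for all $j\in\mathcal U\setminus\hat{\mathcal S}_u$; $\hat\kappa^{j\gets t_u}\le\hat\kappa^{(j,k)\gets(t_u,t_c)}\le\hat\kappa^{j\gets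 t_u}+I_c$ for all $j\in\mathcal U$, $k\in\mathcal C$; and $\lceil\gamma m\rceil\le\hat\kappa\le m-1$. 3. Let $F_R,F_T$ be the distribution functions of $R_i,T_i$ and $F_{(R,T)}$ the joint distribution function of $(F_R(R_i),F_T(T_i))$. There is $\rho\in(0,1)$ such that, for all $t\in[\gamma/2,1]$ and $r\in(0,1)$, $\partial F_{(R,T)}(r,t)/\partial r$ exists and is at least $\rho t$. If $n\gamma\ge256\log n$ and $m\gamma\ge32\log m$, then $$|\mathrm{FCR}-\alpha|\le C\left\{\frac1{\rho\gamma^3}\left(\frac{I_c\log m}{m}+\frac{\log n}{n}\right)+\frac{I_u\log m}{m\gamma}\right\},$$ where $C>0$ is an absolute constant (independent of $n,m,d,\alpha,\gamma,\rho,I_u,I_c,t_u,t_c,\hat\kappa,g,\hat\mu$ and of the law of the data). -/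

import Mathlib

open MeasureTheory ProbabilityTheory Set

namespace SCOP

noncomputable section

/-- The `k`-th smallest of the values `v i`, `i ∈ S`, as an extended real:
it is `+∞` when `k` exceeds the number of elements of `S`. -/
def kthSmallest {ι : Type*} (S : Finset ι) (v : ι → ℝ) (k : ℕ) : EReal :=
  sInf {t : EReal | k ≤ (S.filter fun i => (v i : EReal) ≤ t).card}

/-- The conformal quantile `Q_α({R_i : i ∈ S})`:
the `⌈(1 - α)(|S| + 1)⌉`-th smallest value of `R_i`, `i ∈ S`. -/
def conformalQuantile {ι : Type*} (α : ℝ) (S : Finset ι) (R : ι → ℝ) : EReal :=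
  kthSmallest S R ⌈(1 - α) * ((S.card : ℝ) + 1)⌉₊

/-! Samples are indexed by `Fin n ⊕ Fin m`: the left summand is the calibration set,
the right summand is the test set. A score vector is `T : Fin n ⊕ Fin m → ℝ`, and a ranking rule is
a function `κ` of the score vector. -/

/-- The `k`-th smallest test score `T_(k)`. -/
def testOrderStat {n m : ℕ} (T : Fin n ⊕ Fin m → ℝ) (k : ℕ) : EReal :=
  kthSmallest Finset.univ (fun j : Fin m => T (Sum.inr j)) k

/-- The selected test set `{j : T_j ≤ T_(κ)}`, where `κ = κ(T)`. -/
def selectedTest {n m : ℕ} (κ : (Fin n ⊕ Fin m → ℝ) → ℕ) (T : Fin n ⊕ Fin m → ℝ) :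
    Finset (Fin m) :=
  Finset.univ.filter fun j => (T (Sum.inr j) : EReal) ≤ testOrderStat T (κ T)

/-- The selected calibration set with inflated threshold, `{i : T_i ≤ T_(κ + 1)}`. -/
def selectedCal {n m : ℕ} (κ : (Fin n ⊕ Fin m → ℝ) → ℕ) (T : Fin n ⊕ Fin m → ℝ) :
    Finset (Fin n) :=
  Finset.univ.filter fun i => (T (Sum.inl i) : EReal) ≤ testOrderStat T (κ T + 1)

/-- The scores `T_i = g(X_i)`. -/
def score {ι E : Type*} (g : E → ℝ) (x : ι → E) : ι → ℝ := fun i => g (x i)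

/-- The residuals `R_i = |Y_i - f(X_i)|` of the prediction model `f`. -/
def residual {ι E : Type*} (f : E → ℝ) (x : ι → E) (y : ι → ℝ) : ι → ℝ :=
  fun i => |y i - f (x i)|

/-- The prediction interval `f(X_j) ± Q_α({R_i : i ∈ S})` of the test point `j`, where `S` is the
selected calibration set with inflated threshold; the whole line when the quantile is `+∞`. -/
def predInterval {n m : ℕ} {E : Type*} (α : ℝ) (κ : (Fin n ⊕ Fin m → ℝ) → ℕ) (g f : E → ℝ)
    (x : Fin n ⊕ Fin m → E) (y : Fin n ⊕ Fin m → ℝ) (j : Fin m) : Set ℝ :=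
  {v : ℝ | ((|v - f (x (Sum.inr j))| : ℝ) : EReal) ≤
    conformalQuantile α (selectedCal κ (score g x)) (fun i : Fin n => residual f x y (Sum.inl i))}

open Classical in
/-- The false coverage proportion
`|{j selected : Y_j ∉ PI_j}| / max (number of selected test points) 1`. -/
def falseCoverageProportion {n m : ℕ} {E : Type*} (α : ℝ) (κ : (Fin n ⊕ Fin m → ℝ) → ℕ)
    (g f : E → ℝ) (x : Fin n ⊕ Fin m → E) (y : Fin n ⊕ Fin m → ℝ) : ℝ :=
  (((selectedTest κ (score g x)).filter
      fun j => y (Sum.inr j) ∉ predInterval α κ g f x y j).card : ℝ) /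
    (max (selectedTest κ (score g x)).card 1 : ℕ)

/-- The false coverage-statement rate: the expected false coverage proportion. -/
def FCR {Ω E : Type*} [MeasurableSpace Ω] (P : Measure Ω) {n m : ℕ} (α : ℝ)
    (κ : (Fin n ⊕ Fin m → ℝ) → ℕ) (g f : E → ℝ)
    (X : Fin n ⊕ Fin m → Ω → E) (Y : Fin n ⊕ Fin m → Ω → ℝ) : ℝ :=
  ∫ ω, falseCoverageProportion α κ g f (fun i => X i ω) (fun i => Y i ω) ∂P

/-- The pairs `(R_i, T_i)` are independent and identically distributed over `i`, and the laws of
`R_i` and of `T_i` have no atoms. -/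
structure IIDContinuous {Ω ι : Type*} [MeasurableSpace Ω] (P : Measure Ω)
    (R T : ι → Ω → ℝ) : Prop where
  indep : iIndepFun (fun i ω => (R i ω, T i ω)) P
  identDistrib : ∀ i j, IdentDistrib (fun ω => (R i ω, T i ω)) (fun ω => (R j ω, T j ω)) P P
  noAtoms_R : ∀ i (x : ℝ), P {ω | R i ω = x} = 0
  noAtoms_T : ∀ i (x : ℝ), P {ω | T i ω = x} = 0

/-- Stability of the ranking threshold under replacing one test score by `tu`, and then one
calibration score by `tc`, together with its range `⌈γ m⌉ ≤ κ ≤ m - 1`. -/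
structure StableRanking {Ω : Type*} [MeasurableSpace Ω] (P : Measure Ω) {n m : ℕ}
    (κ : (Fin n ⊕ Fin m → ℝ) → ℕ) (T : Fin n ⊕ Fin m → Ω → ℝ)
    (γ tu tc : ℝ) (Iu Ic : ℕ) : Prop where
  selected : ∀ᵐ ω ∂P, ∀ j ∈ selectedTest κ (fun i => T i ω),
    κ (Function.update (fun i => T i ω) (Sum.inr j) tu) = κ (fun i => T i ω)
  unselected : ∀ᵐ ω ∂P, ∀ j ∉ selectedTest κ (fun i => T i ω),
    κ (fun i => T i ω) ≤ κ (Function.update (fun i => T i ω) (Sum.inr j) tu) ∧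
    κ (Function.update (fun i => T i ω) (Sum.inr j) tu) ≤ κ (fun i => T i ω) + Iu
  pair : ∀ᵐ ω ∂P, ∀ (j : Fin m) (k : Fin n),
    κ (Function.update (fun i => T i ω) (Sum.inr j) tu) ≤
      κ (Function.update (Function.update (fun i => T i ω) (Sum.inr j) tu) (Sum.inl k) tc) ∧
    κ (Function.update (Function.update (fun i => T i ω) (Sum.inr j) tu) (Sum.inl k) tc) ≤
      κ (Function.update (fun i => T i ω) (Sum.inr j) tu) + Ic
  range : ∀ᵐ ω ∂P, ⌈γ * (m : ℝ)⌉₊ ≤ κ (fun i => T i ω) ∧ κ (fun i => T i ω) + 1 ≤ m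

/-- The joint cumulative distribution function of `(F_R(R), F_T(T))`, where `F_R` and `F_T` are the
cumulative distribution functions of the random variables `R` and `T`. -/
def jointCDF {Ω : Type*} [MeasurableSpace Ω] (P : Measure Ω) (R T : Ω → ℝ) (r t : ℝ) : ℝ :=
  P.real {ω | cdf (P.map R) (R ω) ≤ r ∧ cdf (P.map T) (T ω) ≤ t}

/-- The joint distribution function is differentiable in `r ∈ (0, 1)` with derivative at least
`ρ t`, for all `t ∈ [γ / 2, 1]`. -/
def JointCDFLowerBound {Ω : Type*} [MeasurableSpace Ω] (P : Measure Ω) (R T : Ω → ℝ)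
    (γ ρ : ℝ) : Prop :=
  ∀ t ∈ Icc (γ / 2) 1, ∀ r ∈ Ioo (0 : ℝ) 1,
    DifferentiableAt ℝ (fun s => jointCDF P R T s t) r ∧
    ρ * t ≤ deriv (fun s => jointCDF P R T s t) r

end

end SCOP

/-! The false coverage proportion minus `α` is the sum over selected test points `j` of `(1{j
missed} - α) / κ`. For such `j`, the calibration points below the inflated threshold `κ + 1`,
together with `j`, are exactly the points of the pool (calibration points and `j`) having fewer than
`κ` test scores other than the `j`-th below them (`poolSel_eq_of_selected`). This set `S` treats all
pool points alike, and `j` is missed iff its residual rank in `S` reaches `⌈(1 - α)|S|⌉`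
(`exceeds_eq_missed`). The number of points of `S` with this property is `α|S|` up to one. So if the
level did not depend on which pool point plays the role of `j`, exchangeability would finish the
proof up to this rounding; the work is to pay for the dependence.

Replace `κ` by the level `a` obtained after overwriting `T_j` by `tu`. Nothing changes for selected
`j`, and an unselected `j` enters the sum only if its rank lies in `[κ, κ + Iu)`, so at most `Iu`
terms of size `1 / κ` are added (`abs_rankFCP_sub_le`). Averaging over `S` turns the term of `j`
into a sum over calibration points `k` of weighted differences of exceedance indicators of `j` and
`k`, with common weight `1 / (a|S|)` (`looTerm_sub_sum_le`). Exchanging the data of `j` and `k`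
preserves the law and carries one indicator to the other, except that `a` becomes a level `b`.
Overwriting both scores gives the same level before and after the exchange (`pairLevel_comp_exch`),
so `|a - b| ≤ Ic`.

Changing the level by `Ic` matters only for points with score near the threshold, for calibration
points with residual rank near the quantile rank, and through the normalisation. All these are
counted by `D`, the largest number of pool points in a window of `Ic` test ranks (`exchCost_le`,
`looCost_le`). Two estimates conclude: `D / n` is of order `Ic log m / m + log n / n` with high
probability, by cutting the score axis into equiprobable cells and using Chernoff bounds
(`measureReal_poolWindow_gt_le`, `exists_poolWindow_bound`); and the mean of `1 / (N + 1)`, where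
`N` counts the calibration points with fewer than `⌈γ m⌉` test scores below, is of order `1 / (γ
n)`, again by exchange (`integral_inv_calBelow_le`). -/

namespace SCOP

/-! ### Ranks in a finite set and the conformal quantile rank -/

/-- A real number exceeds the `k`-th smallest value iff at least `k` values lie below it. -/
lemma kthSmallest_lt_iff {ι : Type*} (S : Finset ι) (v : ι → ℝ) (k : ℕ) (x : ℝ) :
    kthSmallest S v k < (x : EReal) ↔ k ≤ (S.filter fun i => v i < x).card := by
  unfold kthSmallest
  rw [sInf_lt_iff]
  constructor
  · rintro ⟨t, ht, htx⟩
    refine le_trans ht (Finset.card_le_card ?_)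
    intro i hi
    simp only [Finset.mem_filter] at hi ⊢
    exact ⟨hi.1, EReal.coe_lt_coe_iff.1 (lt_of_le_of_lt hi.2 htx)⟩
  · intro h
    -- The largest value below `x`, and `⊥` if there is none, which covers `k = 0`.
    refine ⟨(S.filter fun i => v i < x).sup fun i => (v i : EReal), ?_, ?_⟩
    · refine le_trans h (Finset.card_le_card ?_)
      intro i hi
      rw [Finset.mem_filter] at hi ⊢
      exact ⟨hi.1, Finset.le_sup (f := fun i => (v i : EReal)) (Finset.mem_filter.2 hi)⟩
    · rw [Finset.sup_lt_iff (EReal.bot_lt_coe x)]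
      intro i hi
      exact EReal.coe_lt_coe_iff.2 (Finset.mem_filter.1 hi).2

/-- The number of elements of `S` whose value is below that of `i`. -/
noncomputable def rankIn {ι : Type*} (S : Finset ι) (v : ι → ℝ) (i : ι) : ℕ :=
  (S.filter fun l => v l < v i).card

lemma rankIn_lt {ι : Type*} {S : Finset ι} {v : ι → ℝ} {i l : ι} (hi : i ∈ S)
    (h : v i < v l) : rankIn S v i < rankIn S v l := by
  refine Finset.card_lt_card ?_
  rw [Finset.ssubset_iff_of_subset]
  · exact ⟨i, by simp [hi, h], by simp⟩
  · intro x hx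
    simp only [Finset.mem_filter] at hx ⊢
    exact ⟨hx.1, hx.2.trans h⟩

lemma rankIn_injOn {ι : Type*} {S : Finset ι} {v : ι → ℝ} (hv : InjOn v S) :
    InjOn (rankIn S v) S := by
  intro i hi l hl h
  by_contra hne
  rcases lt_or_gt_of_ne (fun h' => hne (hv hi hl h')) with h' | h'
  · exact absurd h (rankIn_lt hi h').ne
  · exact absurd h (rankIn_lt hl h').ne'

lemma rankIn_lt_card {ι : Type*} {S : Finset ι} {v : ι → ℝ} {i : ι} (hi : i ∈ S) :
    rankIn S v i < S.card := by
  refine Finset.card_lt_card ?_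
  rw [Finset.ssubset_iff_of_subset (Finset.filter_subset _ _)]
  exact ⟨i, hi, by simp⟩

lemma image_rankIn {ι : Type*} {S : Finset ι} {v : ι → ℝ} (hv : InjOn v S) :
    S.image (rankIn S v) = Finset.range S.card := by
  refine Finset.eq_of_subset_of_card_le ?_ ?_
  · intro x hx
    obtain ⟨i, hi, rfl⟩ := Finset.mem_image.1 hx
    exact Finset.mem_range.2 (rankIn_lt_card hi)
  · rw [Finset.card_image_of_injOn (rankIn_injOn hv), Finset.card_range]

/-- The ranks of the elements of `S` are `0, …, |S| - 1`, each attained once. -/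
lemma card_filter_rankIn {ι : Type*} {S : Finset ι} {v : ι → ℝ} (hv : InjOn v S)
    (p : ℕ → Prop) [DecidablePred p] :
    (S.filter fun i => p (rankIn S v i)).card = ((Finset.range S.card).filter p).card := by
  classical
  rw [← image_rankIn hv, Finset.filter_image, Finset.card_image_of_injOn]
  intro i hi l hl h
  exact rankIn_injOn hv (Finset.mem_filter.1 hi).1 (Finset.mem_filter.1 hl).1 h

lemma card_filter_rankIn_window {ι : Type*} {S : Finset ι} {v : ι → ℝ} (hv : InjOn v S)
    (a b : ℕ) :
    (S.filter fun i => a ≤ rankIn S v i ∧ rankIn S v i < b).card ≤ b - a := by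
  rw [card_filter_rankIn hv (fun x => a ≤ x ∧ x < b), ← Nat.card_Ico]
  refine Finset.card_le_card fun x hx => ?_
  simp only [Finset.mem_filter, Finset.mem_Ico] at hx ⊢
  exact hx.2

/-- The rank from which a residual of `S` exceeds the conformal quantile of the others. -/
noncomputable def quantileRank (α : ℝ) (s : ℕ) : ℕ := ⌈(1 - α) * (s : ℝ)⌉₊

lemma quantileRank_mono {α : ℝ} (hα : α ∈ Ioo (0 : ℝ) 1) {s s' : ℕ} (h : s ≤ s') :
    quantileRank α s ≤ quantileRank α s' := by
  refine Nat.ceil_mono ?_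
  have : (s : ℝ) ≤ s' := by exact_mod_cast h
  nlinarith [hα.1, hα.2]

lemma quantileRank_add_le {α : ℝ} (hα : α ∈ Ioo (0 : ℝ) 1) (s d : ℕ) :
    quantileRank α (s + d) ≤ quantileRank α s + d := by
  refine Nat.ceil_le.2 ?_
  have h := Nat.le_ceil ((1 - α) * (s : ℝ))
  have hd : (0 : ℝ) ≤ d := Nat.cast_nonneg d
  push_cast
  unfold quantileRank
  nlinarith [hα.1, hα.2]

lemma quantileRank_le {α : ℝ} (hα : α ∈ Ioo (0 : ℝ) 1) (s : ℕ) : quantileRank α s ≤ s := by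
  simpa [quantileRank] using quantileRank_add_le hα 0 s

/-- Indicator that `i` has rank at least `quantileRank α |S|` in `S`. -/
noncomputable def exceeds {ι : Type*} (α : ℝ) (v : ι → ℝ) (S : Finset ι) (i : ι) : ℝ :=
  if quantileRank α S.card ≤ rankIn S v i then 1 else 0

lemma exceeds_nonneg {ι : Type*} (α : ℝ) (v : ι → ℝ) (S : Finset ι) (i : ι) :
    0 ≤ exceeds α v S i := by
  unfold exceeds; split_ifs <;> simp

lemma exceeds_le_one {ι : Type*} (α : ℝ) (v : ι → ℝ) (S : Finset ι) (i : ι) :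
    exceeds α v S i ≤ 1 := by
  unfold exceeds; split_ifs <;> simp

lemma abs_exceeds_sub_le {ι : Type*} {α : ℝ} (hα : α ∈ Ioo (0 : ℝ) 1) (v : ι → ℝ)
    (S : Finset ι) (i : ι) : |exceeds α v S i - α| ≤ 1 := by
  have h0 := exceeds_nonneg α v S i
  have h1 := exceeds_le_one α v S i
  rw [abs_le]
  constructor <;> linarith [hα.1, hα.2]

/-- The number of elements of `S` exceeding the quantile is `α |S|` up to one. -/
lemma abs_sum_exceeds_sub_le {ι : Type*} {α : ℝ} (hα : α ∈ Ioo (0 : ℝ) 1) {v : ι → ℝ}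
    {S : Finset ι} (hv : InjOn v S) : |∑ i ∈ S, (exceeds α v S i - α)| ≤ 1 := by
  classical
  have h1 : ∑ i ∈ S, exceeds α v S i = (S.card : ℝ) - quantileRank α S.card := by
    have hc : (S.filter fun i => quantileRank α S.card ≤ rankIn S v i).card =
        S.card - quantileRank α S.card := by
      have h := card_filter_rankIn hv (fun x => quantileRank α S.card ≤ x)
      have h2 : ((Finset.range S.card).filter fun x => quantileRank α S.card ≤ x) =
          Finset.Ico (quantileRank α S.card) S.card := by
        ext x; simp [and_comm]
      rw [h2, Nat.card_Ico] at h
      rw [← h]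
    unfold exceeds
    rw [Finset.sum_ite, Finset.sum_const_zero, add_zero, Finset.sum_const, nsmul_eq_mul, mul_one,
      hc, Nat.cast_sub (quantileRank_le hα _)]
  rw [Finset.sum_sub_distrib, h1, Finset.sum_const, nsmul_eq_mul]
  have hα1 : 0 ≤ (1 - α) * (S.card : ℝ) :=
    mul_nonneg (by linarith [hα.2]) (Nat.cast_nonneg _)
  have h2 := Nat.le_ceil ((1 - α) * (S.card : ℝ))
  have h3 := Nat.ceil_lt_add_one hα1
  unfold quantileRank
  rw [abs_le]
  constructor <;> linarith

/-- If `S'` differs from `S` by at most `D` elements in one direction, then an element on whose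
exceedance `S` and `S'` disagree has rank within `D` of the quantile rank of `S`. -/
lemma rankIn_mem_window_of_exceeds_ne {ι : Type*} {α : ℝ} (hα : α ∈ Ioo (0 : ℝ) 1) {v : ι → ℝ}
    {S S' : Finset ι} {D : ℕ} (hS : (S ⊆ S' ∧ S'.card ≤ S.card + D) ∨
      (S' ⊆ S ∧ S.card ≤ S'.card + D)) {i : ι} (hi : exceeds α v S' i ≠ exceeds α v S i) :
    quantileRank α S.card - D ≤ rankIn S v i ∧ rankIn S v i < quantileRank α S.card + D := by
  -- Adding at most `D` elements raises both the rank of `i` and the quantile rank, each by at most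
  -- `D`, so their comparison can flip only when they are within `D` of each other.
  have key : ∀ A B : Finset ι, A ⊆ B → B.card ≤ A.card + D →
      rankIn A v i ≤ rankIn B v i ∧ rankIn B v i ≤ rankIn A v i + D ∧
      quantileRank α A.card ≤ quantileRank α B.card ∧
      quantileRank α B.card ≤ quantileRank α A.card + D := by
    intro A B hAB hc
    classical
    refine ⟨Finset.card_le_card (Finset.filter_subset_filter _ hAB), ?_,
      quantileRank_mono hα (Finset.card_le_card hAB),
      (quantileRank_mono hα hc).trans (quantileRank_add_le hα _ _)⟩
    have h1 : (B.filter fun l => v l < v i) ⊆ (A.filter fun l => v l < v i) ∪ (B \ A) := by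
      intro l hl
      simp only [Finset.mem_filter, Finset.mem_union, Finset.mem_sdiff] at hl ⊢
      tauto
    have h2 := (Finset.card_le_card h1).trans (Finset.card_union_le _ _)
    have h3 := Finset.card_sdiff_add_card_eq_card hAB
    unfold rankIn
    omega
  unfold exceeds at hi
  rcases hS with ⟨h, hc⟩ | ⟨h, hc⟩
  · have := key _ _ h hc
    split_ifs at hi <;> first | exact absurd rfl hi | omega
  · have := key _ _ h hc
    split_ifs at hi <;> first | exact absurd rfl hi | omega

end SCOP

/-! ### Leave-one-out ranks, the pool of a test point, and exchanges -/

namespace SCOP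

noncomputable section

variable {n m : ℕ}

/-- The number of test scores below the score of `i`. -/
def testRank (T : Fin n ⊕ Fin m → ℝ) (i : Fin n ⊕ Fin m) : ℕ :=
  (Finset.univ.filter fun l : Fin m => T (Sum.inr l) < T i).card

/-- The number of test scores other than the `j`-th below the score of `i`. -/
def looRank (j : Fin m) (T : Fin n ⊕ Fin m → ℝ) (i : Fin n ⊕ Fin m) : ℕ :=
  (Finset.univ.filter fun l : Fin m => l ≠ j ∧ T (Sum.inr l) < T i).card

/-- The calibration points together with the test point `j`. -/
def pool (j : Fin m) : Finset (Fin n ⊕ Fin m) :=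
  insert (Sum.inr j) (Finset.univ.map ⟨Sum.inl, Sum.inl_injective⟩)

/-- The points of the pool below the `a`-th smallest test score, the `j`-th score left out. -/
def poolSel (j : Fin m) (T : Fin n ⊕ Fin m → ℝ) (a : ℕ) : Finset (Fin n ⊕ Fin m) :=
  (pool j).filter fun i => looRank j T i < a

lemma inr_mem_pool (j : Fin m) : (Sum.inr j : Fin n ⊕ Fin m) ∈ pool j := by simp [pool]

lemma inl_mem_pool (j : Fin m) (k : Fin n) : (Sum.inl k : Fin n ⊕ Fin m) ∈ pool j := by
  simp [pool]

lemma sum_pool (j : Fin m) (f : Fin n ⊕ Fin m → ℝ) :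
    ∑ i ∈ pool j, f i = f (Sum.inr j) + ∑ k, f (Sum.inl k) := by
  rw [pool, Finset.sum_insert (by simp), Finset.sum_map]
  rfl

lemma looRank_le_testRank (j : Fin m) (T : Fin n ⊕ Fin m → ℝ) (i : Fin n ⊕ Fin m) :
    looRank j T i ≤ testRank T i := by
  refine Finset.card_le_card fun l hl => ?_
  simp only [Finset.mem_filter] at hl ⊢
  exact ⟨hl.1, hl.2.2⟩

lemma testRank_eq_looRank_add (j : Fin m) (T : Fin n ⊕ Fin m → ℝ) (i : Fin n ⊕ Fin m) :
    testRank T i = looRank j T i + if T (Sum.inr j) < T i then 1 else 0 := by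
  classical
  unfold testRank looRank
  split_ifs with h
  · have : (Finset.univ.filter fun l : Fin m => T (Sum.inr l) < T i) =
        insert j (Finset.univ.filter fun l : Fin m => l ≠ j ∧ T (Sum.inr l) < T i) := by
      ext l
      by_cases hl : l = j
      · subst hl; simp [h]
      · simp [hl]
    rw [this, Finset.card_insert_of_notMem (by simp)]
  · rw [add_zero]
    congr 1
    ext l
    by_cases hl : l = j
    · subst hl; simpa using h
    · simp [hl]

lemma looRank_self (j : Fin m) (T : Fin n ⊕ Fin m → ℝ) :
    looRank j T (Sum.inr j) = testRank T (Sum.inr j) := by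
  rw [testRank_eq_looRank_add j]; simp

lemma testRank_mono {T : Fin n ⊕ Fin m → ℝ} {i l : Fin n ⊕ Fin m} (h : T i ≤ T l) :
    testRank T i ≤ testRank T l := by
  refine Finset.card_le_card fun x hx => ?_
  simp only [Finset.mem_filter] at hx ⊢
  exact ⟨hx.1, hx.2.trans_le h⟩

/-- The exchange of the calibration point `k` with the test point `j`. -/
abbrev exch (k : Fin n) (j : Fin m) : Equiv.Perm (Fin n ⊕ Fin m) :=
  Equiv.swap (Sum.inl k) (Sum.inr j)

lemma exch_inr_of_ne (k : Fin n) {j l : Fin m} (h : l ≠ j) :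
    exch k j (Sum.inr l) = Sum.inr l :=
  Equiv.swap_apply_of_ne_of_ne (by simp) (by simpa using h)

lemma exch_exch (k : Fin n) (j : Fin m) (i : Fin n ⊕ Fin m) : exch k j (exch k j i) = i :=
  Equiv.swap_apply_self _ _ _

/-- The scores counted belong to test points other than `j`, which the exchange leaves fixed, so the
rank follows the point. Full test ranks lack this equivariance. -/
lemma looRank_comp_exch (k : Fin n) (j : Fin m) (T : Fin n ⊕ Fin m → ℝ) (i : Fin n ⊕ Fin m) :
    looRank j (T ∘ exch k j) i = looRank j T (exch k j i) := by
  unfold looRank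
  congr 1
  ext l
  by_cases hl : l = j
  · simp [hl]
  · simp only [Finset.mem_filter, Function.comp, exch_inr_of_ne k hl]

lemma exch_mem_pool (k : Fin n) (j : Fin m) (i : Fin n ⊕ Fin m) :
    exch k j i ∈ pool j ↔ i ∈ pool j := by
  have h : ∀ i, i ∈ pool j → exch k j i ∈ pool j := by
    intro i hi
    by_cases h1 : i = Sum.inl k
    · subst h1; rw [exch, Equiv.swap_apply_left]; exact inr_mem_pool j
    by_cases h2 : i = Sum.inr j
    · subst h2; rw [exch, Equiv.swap_apply_right]; exact inl_mem_pool j k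
    rwa [exch, Equiv.swap_apply_of_ne_of_ne h1 h2]
  exact ⟨fun hi => by simpa [exch_exch] using h _ hi, h i⟩

lemma mem_poolSel_comp_exch (k : Fin n) (j : Fin m) (T : Fin n ⊕ Fin m → ℝ) (a : ℕ)
    (i : Fin n ⊕ Fin m) :
    i ∈ poolSel j (T ∘ exch k j) a ↔ exch k j i ∈ poolSel j T a := by
  simp only [poolSel, Finset.mem_filter, looRank_comp_exch, exch_mem_pool]

lemma poolSel_comp_exch (k : Fin n) (j : Fin m) (T : Fin n ⊕ Fin m → ℝ) (a : ℕ) :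
    poolSel j (T ∘ exch k j) a = (poolSel j T a).map (exch k j).toEmbedding := by
  ext i
  rw [mem_poolSel_comp_exch, Finset.mem_map_equiv, exch, Equiv.symm_swap]

lemma rankIn_map_equiv {ι : Type*} (S : Finset ι) (e : Equiv.Perm ι) (v : ι → ℝ)
    (i : ι) : rankIn (S.map e.toEmbedding) (v ∘ e.symm) (e i) = rankIn S v i := by
  unfold rankIn
  rw [Finset.filter_map, Finset.card_map]
  congr 1
  ext l
  simp

/-- At a fixed level the selected pool and the residuals are relabelled together. Hence an exchange
affects exceedance only through the level. -/
lemma exceeds_poolSel_comp_exch (α : ℝ) (k : Fin n) (j : Fin m) (R T : Fin n ⊕ Fin m → ℝ) (a : ℕ)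
    (i : Fin n ⊕ Fin m) :
    exceeds α (R ∘ exch k j) (poolSel j (T ∘ exch k j) a) i =
      exceeds α R (poolSel j T a) (exch k j i) := by
  have h := rankIn_map_equiv (poolSel j T a) (exch k j) R (exch k j i)
  rw [exch_exch, exch, Equiv.symm_swap] at h
  unfold exceeds
  rw [poolSel_comp_exch, Finset.card_map, h]

lemma poolSel_mono (j : Fin m) (T : Fin n ⊕ Fin m → ℝ) {a b : ℕ} (h : a ≤ b) :
    poolSel j T a ⊆ poolSel j T b := by
  intro i hi
  simp only [poolSel, Finset.mem_filter] at hi ⊢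
  exact ⟨hi.1, hi.2.trans_le h⟩

/-- The weight of the pair `(j, k)`: `1 / (a |S|)` if both are selected at level `a`. -/
def pairWeight (j : Fin m) (T : Fin n ⊕ Fin m → ℝ) (a : ℕ) (k : Fin n) : ℝ :=
  if Sum.inr j ∈ poolSel j T a ∧ Sum.inl k ∈ poolSel j T a then
    ((a : ℝ) * (poolSel j T a).card)⁻¹ else 0

lemma pairWeight_nonneg (j : Fin m) (T : Fin n ⊕ Fin m → ℝ) (a : ℕ) (k : Fin n) :
    0 ≤ pairWeight j T a k := by
  unfold pairWeight; split_ifs <;> positivity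

lemma pairWeight_comp_exch (j : Fin m) (T : Fin n ⊕ Fin m → ℝ) (a : ℕ) (k : Fin n) :
    pairWeight j (T ∘ exch k j) a k = pairWeight j T a k := by
  unfold pairWeight
  have h : (Sum.inr j ∈ poolSel j (T ∘ exch k j) a ∧ Sum.inl k ∈ poolSel j (T ∘ exch k j) a) ↔
      (Sum.inr j ∈ poolSel j T a ∧ Sum.inl k ∈ poolSel j T a) := by
    rw [mem_poolSel_comp_exch, mem_poolSel_comp_exch, exch, Equiv.swap_apply_left,
      Equiv.swap_apply_right, and_comm]
  have h2 : (poolSel j (T ∘ exch k j) a).card = (poolSel j T a).card := by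
    rw [poolSel_comp_exch, Finset.card_map]
  simp only [h, h2]

/-! ### Averaging the miscoverage of a test point over its pool -/

/-- The centred, weighted miscoverage of the test point `j` at level `a`. -/
def looTerm (α : ℝ) (j : Fin m) (R T : Fin n ⊕ Fin m → ℝ) (a : ℕ) : ℝ :=
  if Sum.inr j ∈ poolSel j T a then (exceeds α R (poolSel j T a) (Sum.inr j) - α) / a else 0

/-- `1 / (a |S|)` if the test point `j` is selected at level `a`. -/
def selfWeight (j : Fin m) (T : Fin n ⊕ Fin m → ℝ) (a : ℕ) : ℝ :=
  if Sum.inr j ∈ poolSel j T a then ((a : ℝ) * (poolSel j T a).card)⁻¹ else 0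

lemma pairWeight_eq (j : Fin m) (T : Fin n ⊕ Fin m → ℝ) (a : ℕ) (k : Fin n) :
    pairWeight j T a k = if Sum.inl k ∈ poolSel j T a then selfWeight j T a else 0 := by
  unfold pairWeight selfWeight
  split_ifs <;> simp_all

lemma selfWeight_nonneg (j : Fin m) (T : Fin n ⊕ Fin m → ℝ) (a : ℕ) :
    0 ≤ selfWeight j T a := by
  unfold selfWeight; split_ifs <;> positivity

lemma sum_poolSel_inl_le (j : Fin m) (T : Fin n ⊕ Fin m → ℝ) (a : ℕ)
    {f : Fin n ⊕ Fin m → ℝ} (hf : ∀ i, 0 ≤ f i) :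
    ∑ k, (if Sum.inl k ∈ poolSel j T a then f (Sum.inl k) else 0) ≤
      ∑ i ∈ poolSel j T a, f i := by
  have h := sum_pool j fun i => if i ∈ poolSel j T a then f i else 0
  rw [← Finset.sum_filter] at h
  have h2 : (pool j).filter (fun i => i ∈ poolSel j T a) = poolSel j T a := by
    ext i; simp [poolSel]
  rw [h2] at h
  rw [h]
  have : 0 ≤ (if Sum.inr j ∈ poolSel j T a then f (Sum.inr j) else 0) := by
    split_ifs
    · exact hf _
    · exact le_rfl
  linarith

/-- With `w = 1 / (a|S|)`, the sum of `w (x_j - x_i)` over `S` is `(x_j - α) / a - w ∑ (x_i - α)`,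
and the last sum is a rounding error of at most one. The term `i = j` vanishes, so only calibration
points remain. -/
lemma looTerm_sub_sum_le {α : ℝ} (hα : α ∈ Ioo (0 : ℝ) 1) (j : Fin m)
    {R : Fin n ⊕ Fin m → ℝ} (hR : Function.Injective R) (T : Fin n ⊕ Fin m → ℝ) (a : ℕ) :
    |looTerm α j R T a - ∑ k, pairWeight j T a k * (exceeds α R (poolSel j T a) (Sum.inr j) -
      exceeds α R (poolSel j T a) (Sum.inl k))| ≤ selfWeight j T a := by
  simp only [pairWeight_eq]
  by_cases hj : Sum.inr j ∈ poolSel j T a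
  · set S := poolSel j T a with hS
    set w := selfWeight j T a with hw
    set x := exceeds α R S with hx
    have h := sum_pool j fun i => if i ∈ S then w * (x (Sum.inr j) - x i) else 0
    rw [← Finset.sum_filter] at h
    have h2 : (pool j).filter (fun i => i ∈ S) = S := by
      ext i; simp [hS, poolSel]
    rw [h2] at h
    simp only [sub_self, mul_zero, ite_self, zero_add] at h
    simp only [ite_mul, zero_mul]
    rw [← h]
    have hs : (0 : ℝ) < S.card := by exact_mod_cast Finset.card_pos.2 ⟨_, hj⟩
    have h3 : ∑ i ∈ S, w * (x (Sum.inr j) - x i) =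
        (x (Sum.inr j) - α) / a - w * ∑ i ∈ S, (x i - α) := by
      rw [← Finset.mul_sum]
      have : ∑ i ∈ S, (x (Sum.inr j) - x i) = S.card * (x (Sum.inr j) - α) -
          ∑ i ∈ S, (x i - α) := by
        simp only [Finset.sum_sub_distrib, Finset.sum_const, nsmul_eq_mul]; ring
      rw [this, hw, selfWeight, if_pos hj, ← hS]
      rw [mul_sub, mul_inv]
      congr 1
      field_simp
    have h4 : looTerm α j R T a = (x (Sum.inr j) - α) / a := by
      rw [looTerm, if_pos hj]
    rw [h3, h4, sub_sub_cancel, abs_mul, abs_of_nonneg (selfWeight_nonneg j T a)]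
    exact mul_le_of_le_one_right (selfWeight_nonneg j T a)
      (abs_sum_exceeds_sub_le hα hR.injOn)
  · simp [looTerm, hj, selfWeight]

/-! ### Deterministic cost of changing the level -/

/-- The cost of comparing levels `a` and `b` for the pair `(j, k)`. -/
def exchCost (α : ℝ) (j : Fin m) (R T : Fin n ⊕ Fin m → ℝ) (a b : ℕ) (k : Fin n) : ℝ :=
  2 * max (pairWeight j T a k - pairWeight j T b k) 0 +
    if pairWeight j T b k ≠ 0 ∧
      exceeds α R (poolSel j T b) (Sum.inl k) ≠ exceeds α R (poolSel j T a) (Sum.inl k)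
    then pairWeight j T a k else 0

/-- The number of pool points with rank in a window of `q` ranks starting at `x`. -/
def poolWindow (j : Fin m) (T : Fin n ⊕ Fin m → ℝ) (q x : ℕ) : ℕ :=
  ((pool j).filter fun i => x ≤ looRank j T i ∧ looRank j T i < x + q).card

lemma card_poolSel_le_add {j : Fin m} {T : Fin n ⊕ Fin m → ℝ} {q D : ℕ}
    (hD : ∀ x, poolWindow j T q x ≤ D) {a b : ℕ} (hab : b ≤ a + q) :
    (poolSel j T b).card ≤ (poolSel j T a).card + D := by
  refine le_trans ?_ (Nat.add_le_add_left (hD a) _)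
  refine le_trans (Finset.card_le_card ?_) (Finset.card_union_le _ _)
  intro i hi
  simp only [poolSel, Finset.mem_filter, Finset.mem_union] at hi ⊢
  by_cases h : looRank j T i < a
  · exact Or.inl ⟨hi.1, h⟩
  · exact Or.inr ⟨hi.1, by omega, by omega⟩

/-- Passing from level `a` to `b` lowers the weight of `(j, k)` in three ways: `k` leaves the
selection, `j` leaves it, or the normalisation `a|S|` grows. The first two force a rank within `q`
of `a`. The last summand covers a change of exceedance, which forces the residual rank of `k` to be
within `D` of the quantile rank. -/
lemma exchCost_le {α : ℝ} (hα : α ∈ Ioo (0 : ℝ) 1) (j : Fin m) (R T : Fin n ⊕ Fin m → ℝ)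
    {q D a b : ℕ} (ha : 0 < a) (hab : a ≤ b + q) (hba : b ≤ a + q)
    (hD : ∀ x, poolWindow j T q x ≤ D) (k : Fin n) :
    exchCost α j R T a b k ≤ pairWeight j T a k *
      (2 * (if a - q ≤ looRank j T (Sum.inl k) then 1 else 0) +
       2 * (if a ≤ testRank T (Sum.inr j) + q then 1 else 0) +
       2 * ((q : ℝ) / a + D / (poolSel j T a).card) +
       if quantileRank α (poolSel j T a).card - D ≤ rankIn (poolSel j T a) R (Sum.inl k) ∧
          rankIn (poolSel j T a) R (Sum.inl k) < quantileRank α (poolSel j T a).card + D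
        then 1 else 0) := by
  unfold exchCost
  have hw := pairWeight_nonneg j T a k
  have hw' := pairWeight_nonneg j T b k
  have ha' : (0 : ℝ) < a := by exact_mod_cast ha
  have hE : (if pairWeight j T b k ≠ 0 ∧ exceeds α R (poolSel j T b) (Sum.inl k) ≠
      exceeds α R (poolSel j T a) (Sum.inl k) then pairWeight j T a k else 0) ≤
      pairWeight j T a k * if quantileRank α (poolSel j T a).card - D ≤
          rankIn (poolSel j T a) R (Sum.inl k) ∧
          rankIn (poolSel j T a) R (Sum.inl k) < quantileRank α (poolSel j T a).card + D
        then 1 else 0 := by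
    by_cases h : pairWeight j T b k ≠ 0 ∧ exceeds α R (poolSel j T b) (Sum.inl k) ≠
      exceeds α R (poolSel j T a) (Sum.inl k)
    · rw [if_pos h, if_pos, mul_one]
      refine rankIn_mem_window_of_exceeds_ne hα ?_ h.2
      rcases le_total a b with h' | h'
      · exact Or.inl ⟨poolSel_mono j T h', card_poolSel_le_add hD hba⟩
      · exact Or.inr ⟨poolSel_mono j T h', card_poolSel_le_add hD hab⟩
    · rw [if_neg h]
      split_ifs <;> simp [hw]
  set c1 : ℝ := if a - q ≤ looRank j T (Sum.inl k) then 1 else 0 with hc1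
  set c2 : ℝ := if a ≤ testRank T (Sum.inr j) + q then 1 else 0 with hc2
  have hc1n : 0 ≤ c1 := by rw [hc1]; split_ifs <;> simp
  have hc2n : 0 ≤ c2 := by rw [hc2]; split_ifs <;> simp
  have hqD : 0 ≤ (q : ℝ) / a + D / (poolSel j T a).card := by positivity
  have hM : max (pairWeight j T a k - pairWeight j T b k) 0 ≤
      pairWeight j T a k * (c1 + c2 + ((q : ℝ) / a + D / (poolSel j T a).card)) := by
    refine max_le ?_ (by positivity)
    by_cases hA : Sum.inr j ∈ poolSel j T a ∧ Sum.inl k ∈ poolSel j T a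
    swap
    · have : pairWeight j T a k = 0 := by rw [pairWeight, if_neg hA]
      rw [this]; linarith
    by_cases hk : Sum.inl k ∈ poolSel j T b
    swap
    · have h1 : c1 = 1 := by
        rw [hc1, if_pos]
        simp only [poolSel, Finset.mem_filter, inl_mem_pool, true_and] at hk
        omega
      rw [h1]; nlinarith
    by_cases hj : Sum.inr j ∈ poolSel j T b
    swap
    · have h1 : c2 = 1 := by
        rw [hc2, if_pos]
        simp only [poolSel, Finset.mem_filter, inr_mem_pool, true_and, looRank_self] at hj
        omega
      rw [h1]; nlinarith
    have key : pairWeight j T a k - pairWeight j T b k ≤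
        pairWeight j T a k * ((q : ℝ) / a + D / (poolSel j T a).card) := by
      have hs : (0 : ℝ) < (poolSel j T a).card := by
        exact_mod_cast Finset.card_pos.2 ⟨_, hA.1⟩
      have hs' : (0 : ℝ) < (poolSel j T b).card := by
        exact_mod_cast Finset.card_pos.2 ⟨_, hj⟩
      rw [pairWeight, if_pos hA, pairWeight, if_pos ⟨hj, hk⟩]
      have hsD : ((poolSel j T b).card : ℝ) ≤ (poolSel j T a).card + D := by
        exact_mod_cast card_poolSel_le_add hD hba
      have hbq : (b : ℝ) ≤ a + q := by exact_mod_cast hba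
      have hb' : (0 : ℝ) < b := by
        have : 0 < b := by
          simp only [poolSel, Finset.mem_filter] at hj
          omega
        exact_mod_cast this
      generalize ((poolSel j T b).card : ℝ) = s' at *
      generalize ((poolSel j T a).card : ℝ) = s at *
      have h1 : (b * s')⁻¹ ≥ ((a + q) * (s + D) : ℝ)⁻¹ := by
        gcongr
      -- With `u = q / a` and `v = D / s` this is `1 / ((1 + u)(1 + v)) ≥ 1 - u - v`; the displayed
      -- difference is a quotient with nonnegative terms.
      have h2 : ((a + q) * (s + D) : ℝ)⁻¹ ≥ (a * s)⁻¹ * (1 - q / a - D / s) := by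
        rw [ge_iff_le, ← sub_nonneg]
        have : ((a + q) * (s + D) : ℝ)⁻¹ - (a * s)⁻¹ * (1 - q / a - D / s) =
          ((q / a) ^ 2 + (D / s) ^ 2 + q / a * (D / s) + q / a * (D / s) * (q / a + D / s))
            / ((a + q) * (s + D)) := by
          field_simp
          ring
        rw [this]
        positivity
      nlinarith
    refine key.trans (mul_le_mul_of_nonneg_left ?_ hw)
    linarith
  nlinarith

lemma card_filter_le_window {j : Fin m} {T : Fin n ⊕ Fin m → ℝ} {q D a : ℕ}
    (hD : ∀ x, poolWindow j T q x ≤ D) :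
    ((poolSel j T a).filter fun i => a - q ≤ looRank j T i).card ≤ D := by
  refine le_trans (Finset.card_le_card ?_) (hD (a - q))
  intro i hi
  simp only [poolSel, Finset.mem_filter] at hi ⊢
  exact ⟨hi.1.1, hi.2, by omega⟩

lemma selfWeight_mul_card (j : Fin m) (T : Fin n ⊕ Fin m → ℝ) (a : ℕ) :
    selfWeight j T a * (poolSel j T a).card = if Sum.inr j ∈ poolSel j T a then (a : ℝ)⁻¹ else 0 := by
  unfold selfWeight
  split_ifs with h
  · have hs : (0 : ℝ) < (poolSel j T a).card := by
      exact_mod_cast Finset.card_pos.2 ⟨_, h⟩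
    rw [mul_inv, mul_assoc, inv_mul_cancel₀ hs.ne', mul_one]
  · simp

lemma selfWeight_le (j : Fin m) (T : Fin n ⊕ Fin m → ℝ) (a : ℕ) :
    selfWeight j T a ≤ (a : ℝ)⁻¹ := by
  unfold selfWeight
  split_ifs with h
  · have hs : (1 : ℝ) ≤ (poolSel j T a).card := by
      exact_mod_cast Finset.card_pos.2 ⟨_, h⟩
    rw [mul_inv]
    exact mul_le_of_le_one_right (by positivity) (inv_le_one_of_one_le₀ hs)
  · positivity

/-- The cost of exchanging `j` with the calibration points, `b k` being the level after the
exchange with `k`. -/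
def looCost (α : ℝ) (j : Fin m) (R T : Fin n ⊕ Fin m → ℝ) (a : ℕ) (b : Fin n → ℕ) : ℝ :=
  selfWeight j T a + ∑ k, exchCost α j R T a (b k) k

/-- For use on the exceptional event, where rank windows may be crowded. Each exchange costs at most
three pair weights, the pair weights sum to at most `1 / a`, and `selfWeight` adds one more `1 / a`.
-/
lemma looCost_le_trivial (α : ℝ) (j : Fin m) (R T : Fin n ⊕ Fin m → ℝ) (a : ℕ)
    (b : Fin n → ℕ) : looCost α j R T a b ≤ 4 * (a : ℝ)⁻¹ := by
  have h1 : ∀ k, exchCost α j R T a (b k) k ≤ 3 * pairWeight j T a k := by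
    intro k
    have hw := pairWeight_nonneg j T a k
    have hw' := pairWeight_nonneg j T (b k) k
    have h1 : max (pairWeight j T a k - pairWeight j T (b k) k) 0 ≤ pairWeight j T a k :=
      max_le (by linarith) hw
    unfold exchCost
    split_ifs <;> linarith
  have h2 : ∑ k, pairWeight j T a k ≤ (a : ℝ)⁻¹ := by
    simp only [pairWeight_eq]
    refine (sum_poolSel_inl_le j T a (f := fun _ => selfWeight j T a)
      (fun _ => selfWeight_nonneg j T a)).trans ?_
    rw [Finset.sum_const, nsmul_eq_mul, mul_comm, selfWeight_mul_card]
    split_ifs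
    · exact le_rfl
    · positivity
  have h3 := Finset.sum_le_sum fun k (_ : k ∈ Finset.univ) => h1 k
  rw [← Finset.mul_sum] at h3
  have := selfWeight_le j T a
  unfold looCost
  linarith

/-- In `6 * D`, the points with score near the threshold, the growth of `|S|` and the residual
window of length `2D` contribute `2D` each. The indicator that `j` itself is near the threshold is
kept, because it is small only after summing over `j`. -/
lemma looCost_le {α : ℝ} (hα : α ∈ Ioo (0 : ℝ) 1) (j : Fin m) {R : Fin n ⊕ Fin m → ℝ}
    (hR : Function.Injective R) (T : Fin n ⊕ Fin m → ℝ)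
    {q D a : ℕ} {b : Fin n → ℕ} (ha : 0 < a) (hab : ∀ k, a ≤ b k + q) (hba : ∀ k, b k ≤ a + q)
    (hD : ∀ x, poolWindow j T q x ≤ D) :
    looCost α j R T a b ≤ (1 + 6 * D) * selfWeight j T a + 2 * q * (a : ℝ)⁻¹ * (a : ℝ)⁻¹ +
      2 * (if a ≤ testRank T (Sum.inr j) + q ∧ testRank T (Sum.inr j) < a then (a : ℝ)⁻¹ else 0)
      := by
  set S := poolSel j T a with hS
  set w := selfWeight j T a with hw
  have hw0 : 0 ≤ w := selfWeight_nonneg j T a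
  have ha' : (0 : ℝ) < a := by exact_mod_cast ha
  set J : ℝ := if a ≤ testRank T (Sum.inr j) + q then 1 else 0 with hJ
  have hJ0 : 0 ≤ J := by rw [hJ]; split_ifs <;> simp
  set f : Fin n ⊕ Fin m → ℝ := fun i => w *
      (2 * (if a - q ≤ looRank j T i then 1 else 0) + 2 * J +
       2 * ((q : ℝ) / a + D / S.card) +
       if quantileRank α S.card - D ≤ rankIn S R i ∧ rankIn S R i < quantileRank α S.card + D
        then 1 else 0) with hf
  have hf0 : ∀ i, 0 ≤ f i := by
    intro i
    rw [hf]
    positivity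
  have h1 : ∑ k, exchCost α j R T a (b k) k ≤ ∑ i ∈ S, f i := by
    refine le_trans (Finset.sum_le_sum fun k _ => ?_) (sum_poolSel_inl_le j T a hf0)
    refine (exchCost_le hα j R T ha (hab k) (hba k) hD k).trans (le_of_eq ?_)
    rw [pairWeight_eq, ite_mul, zero_mul]
  have h2 : ∑ i ∈ S, f i = w * (2 * ((S.filter fun i => a - q ≤ looRank j T i).card : ℝ) +
      ((S.filter fun i => quantileRank α S.card - D ≤ rankIn S R i ∧
        rankIn S R i < quantileRank α S.card + D).card : ℝ)) + (w * S.card) * (2 * J +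
        2 * ((q : ℝ) / a)) + 2 * ((w * S.card) * (D / S.card)) := by
    rw [hf, ← Finset.mul_sum]
    simp only [Finset.sum_add_distrib, ← Finset.mul_sum, Finset.sum_const, nsmul_eq_mul,
      Finset.sum_boole]
    ring
  have h3 : ((S.filter fun i => a - q ≤ looRank j T i).card : ℝ) ≤ D := by
    exact_mod_cast card_filter_le_window hD
  have h4 : ((S.filter fun i => quantileRank α S.card - D ≤ rankIn S R i ∧
        rankIn S R i < quantileRank α S.card + D).card : ℝ) ≤ 2 * D := by
    have := card_filter_rankIn_window (hR.injOn (s := (S : Set _)))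
      (quantileRank α S.card - D) (quantileRank α S.card + D)
    have h : (S.filter fun i => quantileRank α S.card - D ≤ rankIn S R i ∧
        rankIn S R i < quantileRank α S.card + D).card ≤ 2 * D := this.trans (by omega)
    exact_mod_cast h
  have h5 : w * S.card = if Sum.inr j ∈ S then (a : ℝ)⁻¹ else 0 := selfWeight_mul_card j T a
  have h6 : (w * S.card) * (D / S.card) ≤ w * D := by
    rw [mul_assoc]
    refine mul_le_mul_of_nonneg_left ?_ hw0
    rcases Nat.eq_zero_or_pos S.card with h | h
    · simp [h]
    · have : (S.card : ℝ) ≠ 0 := by positivity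
      rw [mul_div_cancel₀ _ this]
  have h7 : (w * S.card) * (2 * J + 2 * ((q : ℝ) / a)) ≤ 2 * q * (a : ℝ)⁻¹ * (a : ℝ)⁻¹ +
      2 * (if a ≤ testRank T (Sum.inr j) + q ∧ testRank T (Sum.inr j) < a then (a : ℝ)⁻¹ else 0)
      := by
    have hin : Sum.inr j ∈ S ↔ testRank T (Sum.inr j) < a := by
      simp [hS, poolSel, inr_mem_pool, looRank_self]
    simp only [h5, hin, hJ, div_eq_mul_inv]
    have : 0 ≤ 2 * q * (a : ℝ)⁻¹ * (a : ℝ)⁻¹ := by positivity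
    by_cases hx : testRank T (Sum.inr j) < a
    · simp only [hx, if_true, and_true]
      split_ifs <;> (apply le_of_eq; ring)
    · simp only [hx, if_false, and_false]
      linarith
  have h8 : w * (2 * ((S.filter fun i => a - q ≤ looRank j T i).card : ℝ) +
      ((S.filter fun i => quantileRank α S.card - D ≤ rankIn S R i ∧
        rankIn S R i < quantileRank α S.card + D).card : ℝ)) ≤ w * (4 * D) :=
    mul_le_mul_of_nonneg_left (by linarith) hw0
  unfold looCost
  rw [h2] at h1
  nlinarith

end

end SCOP

/-! ### Measurability of the rank functionals -/

namespace SCOP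

noncomputable section

variable {n m : ℕ} {Z : Type*} [MeasurableSpace Z]

lemma measurable_card_filter {ι : Type*} (S : Finset ι) {p : Z → ι → Prop}
    [∀ z, DecidablePred (p z)] (hp : ∀ i, MeasurableSet {z | p z i}) :
    Measurable fun z => (S.filter (p z)).card := by
  simp only [Finset.card_filter]
  exact Finset.measurable_sum _ fun i _ =>
    Measurable.ite (hp i) measurable_const measurable_const

variable {R T : Z → Fin n ⊕ Fin m → ℝ} {a b : Z → ℕ}

lemma measurableSet_coord_lt (hT : Measurable T) (i l : Fin n ⊕ Fin m) :
    MeasurableSet {z | T z i < T z l} :=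
  measurableSet_lt (by fun_prop) (by fun_prop)

lemma measurable_testRank (hT : Measurable T) (i : Fin n ⊕ Fin m) :
    Measurable fun z => testRank (T z) i :=
  measurable_card_filter _ fun _ => measurableSet_coord_lt hT _ _

lemma measurable_looRank (hT : Measurable T) (j : Fin m) (i : Fin n ⊕ Fin m) :
    Measurable fun z => looRank j (T z) i :=
  measurable_card_filter _ fun _ => (MeasurableSet.const _).inter (measurableSet_coord_lt hT _ _)

lemma measurableSet_mem_poolSel (hT : Measurable T) (ha : Measurable a) (j : Fin m)
    (i : Fin n ⊕ Fin m) : MeasurableSet {z | i ∈ poolSel j (T z) (a z)} := by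
  simp only [poolSel, Finset.mem_filter]
  exact (MeasurableSet.const _).inter (measurableSet_lt (measurable_looRank hT j i) ha)

lemma measurable_card_poolSel (hT : Measurable T) (ha : Measurable a) (j : Fin m) :
    Measurable fun z => (poolSel j (T z) (a z)).card :=
  measurable_card_filter _ fun i => measurableSet_lt (measurable_looRank hT j i) ha

lemma measurable_rankIn_poolSel (hR : Measurable R) (hT : Measurable T) (ha : Measurable a)
    (j : Fin m) (i : Fin n ⊕ Fin m) :
    Measurable fun z => rankIn (poolSel j (T z) (a z)) (R z) i := by
  simp only [rankIn, poolSel, Finset.filter_filter]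
  exact measurable_card_filter _ fun l => (measurableSet_lt (measurable_looRank hT j l) ha).inter
    (measurableSet_coord_lt hR _ _)

lemma measurable_exceeds (α : ℝ) (hR : Measurable R) (hT : Measurable T) (ha : Measurable a)
    (j : Fin m) (i : Fin n ⊕ Fin m) :
    Measurable fun z => exceeds α (R z) (poolSel j (T z) (a z)) i :=
  Measurable.ite (measurableSet_le
    ((Measurable.of_discrete (f := quantileRank α)).comp (measurable_card_poolSel hT ha j))
    (measurable_rankIn_poolSel hR hT ha j i)) measurable_const measurable_const

lemma measurable_inv_level (hT : Measurable T) (ha : Measurable a) (j : Fin m) :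
    Measurable fun z => ((a z : ℝ) * (poolSel j (T z) (a z)).card)⁻¹ :=
  (((Measurable.of_discrete (f := fun x : ℕ => (x : ℝ))).comp ha).mul
    ((Measurable.of_discrete (f := fun x : ℕ => (x : ℝ))).comp
      (measurable_card_poolSel hT ha j))).inv

lemma measurable_pairWeight (hT : Measurable T) (ha : Measurable a) (j : Fin m) (k : Fin n) :
    Measurable fun z => pairWeight j (T z) (a z) k :=
  Measurable.ite ((measurableSet_mem_poolSel hT ha j _).inter
    (measurableSet_mem_poolSel hT ha j _)) (measurable_inv_level hT ha j) measurable_const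

lemma measurable_selfWeight (hT : Measurable T) (ha : Measurable a) (j : Fin m) :
    Measurable fun z => selfWeight j (T z) (a z) :=
  Measurable.ite (measurableSet_mem_poolSel hT ha j _) (measurable_inv_level hT ha j)
    measurable_const

lemma measurable_looTerm (α : ℝ) (hR : Measurable R) (hT : Measurable T) (ha : Measurable a)
    (j : Fin m) : Measurable fun z => looTerm α j (R z) (T z) (a z) :=
  Measurable.ite (measurableSet_mem_poolSel hT ha j _)
    (((measurable_exceeds α hR hT ha j _).sub_const α).div
      ((Measurable.of_discrete (f := fun x : ℕ => (x : ℝ))).comp ha)) measurable_const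

lemma measurable_exchCost (α : ℝ) (hR : Measurable R) (hT : Measurable T) (ha : Measurable a)
    (hb : Measurable b) (j : Fin m) (k : Fin n) :
    Measurable fun z => exchCost α j (R z) (T z) (a z) (b z) k := by
  have h1 := measurable_pairWeight hT ha j k
  have h2 := measurable_pairWeight hT hb j k
  have h3 := measurable_exceeds α hR hT ha j (Sum.inl k)
  have h4 := measurable_exceeds α hR hT hb j (Sum.inl k)
  refine (((h1.sub h2).max measurable_const).const_mul 2).add (Measurable.ite ?_ h1
    measurable_const)
  exact (measurableSet_eq_fun h2 measurable_const).compl.inter (measurableSet_eq_fun h4 h3).compl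

lemma measurable_looCost (α : ℝ) (hR : Measurable R) (hT : Measurable T) (ha : Measurable a)
    {b : Z → Fin n → ℕ} (hb : ∀ k, Measurable fun z => b z k) (j : Fin m) :
    Measurable fun z => looCost α j (R z) (T z) (a z) (b z) :=
  (measurable_selfWeight hT ha j).add
    (Finset.measurable_sum _ fun k _ => measurable_exchCost α hR hT ha (hb k) j k)

lemma pairWeight_le_one (j : Fin m) (T : Fin n ⊕ Fin m → ℝ) (a : ℕ) (k : Fin n) :
    pairWeight j T a k ≤ 1 := by
  unfold pairWeight
  split_ifs
  · rw [← Nat.cast_mul]; exact Nat.cast_inv_le_one _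
  · simp

lemma abs_looTerm_le {α : ℝ} (hα : α ∈ Ioo (0 : ℝ) 1) (j : Fin m) (R T : Fin n ⊕ Fin m → ℝ)
    (a : ℕ) : |looTerm α j R T a| ≤ (a : ℝ)⁻¹ := by
  unfold looTerm
  split_ifs
  · rw [abs_div, Nat.abs_cast, div_eq_mul_inv]
    exact mul_le_of_le_one_left (by positivity) (abs_exceeds_sub_le hα _ _ _)
  · simp

lemma looCost_nonneg (α : ℝ) (j : Fin m) (R T : Fin n ⊕ Fin m → ℝ) (a : ℕ) (b : Fin n → ℕ) :
    0 ≤ looCost α j R T a b := by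
  refine add_nonneg (selfWeight_nonneg j T a) (Finset.sum_nonneg fun k _ => ?_)
  have := pairWeight_nonneg j T a k
  unfold exchCost
  split_ifs <;> positivity

end

/-! ### Exchangeability of the sample law -/

noncomputable section

variable {n m : ℕ} (ν : Measure (ℝ × ℝ)) [IsProbabilityMeasure ν]

/-- The law of a sample of independent pairs with law `ν`. -/
abbrev sampleLaw (n m : ℕ) (ν : Measure (ℝ × ℝ)) : Measure (Fin n ⊕ Fin m → ℝ × ℝ) :=
  Measure.pi fun _ => ν

/-- The residuals of a sample of pairs. -/
abbrev fsts {n m : ℕ} (z : Fin n ⊕ Fin m → ℝ × ℝ) : Fin n ⊕ Fin m → ℝ := fun i => (z i).1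

/-- The scores of a sample of pairs. -/
abbrev snds {n m : ℕ} (z : Fin n ⊕ Fin m → ℝ × ℝ) : Fin n ⊕ Fin m → ℝ := fun i => (z i).2

lemma measurable_fsts : Measurable (fsts (n := n) (m := m)) := by unfold fsts; fun_prop

lemma measurable_snds : Measurable (snds (n := n) (m := m)) := by unfold snds; fun_prop

lemma measurePreserving_comp_perm (σ : Equiv.Perm (Fin n ⊕ Fin m)) :
    MeasurePreserving (fun z : Fin n ⊕ Fin m → ℝ × ℝ => z ∘ σ) (sampleLaw n m ν)
      (sampleLaw n m ν) := by
  have h := measurePreserving_piCongrLeft (α := fun _ : Fin n ⊕ Fin m => ℝ × ℝ)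
    (fun _ => ν) σ.symm
  convert h using 1
  funext z i
  rw [MeasurableEquiv.coe_piCongrLeft]
  have h := Equiv.piCongrLeft_apply_apply (fun _ : Fin n ⊕ Fin m => ℝ × ℝ) σ.symm z (σ i)
  rw [Equiv.symm_apply_apply] at h
  exact h.symm

lemma integral_comp_perm (σ : Equiv.Perm (Fin n ⊕ Fin m)) (F : (Fin n ⊕ Fin m → ℝ × ℝ) → ℝ) :
    ∫ z, F (z ∘ σ) ∂(sampleLaw n m ν) = ∫ z, F z ∂(sampleLaw n m ν) := by
  refine (measurePreserving_comp_perm ν σ).integral_comp ?_ F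
  refine MeasurableEquiv.measurableEmbedding
    (⟨⟨fun z => z ∘ σ, fun z => z ∘ σ.symm, fun z => ?_, fun z => ?_⟩, ?_, ?_⟩ :
      (Fin n ⊕ Fin m → ℝ × ℝ) ≃ᵐ (Fin n ⊕ Fin m → ℝ × ℝ))
  · ext i <;> simp
  · ext i <;> simp
  · exact measurable_pi_lambda _ fun i => measurable_pi_apply _
  · exact measurable_pi_lambda _ fun i => measurable_pi_apply _

lemma ae_comp_perm {p : (Fin n ⊕ Fin m → ℝ × ℝ) → Prop} (σ : Equiv.Perm (Fin n ⊕ Fin m))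
    (h : ∀ᵐ z ∂(sampleLaw n m ν), p z) : ∀ᵐ z ∂(sampleLaw n m ν), p (z ∘ σ) :=
  (measurePreserving_comp_perm ν σ).quasiMeasurePreserving.ae h

/-- The level after the `j`-th test score has been replaced by `tu`. -/
def looLevel (κ : (Fin n ⊕ Fin m → ℝ) → ℕ) (tu : ℝ) (j : Fin m) (T : Fin n ⊕ Fin m → ℝ) : ℕ :=
  κ (Function.update T (Sum.inr j) tu)

lemma measurable_looLevel {κ : (Fin n ⊕ Fin m → ℝ) → ℕ} (hκ : Measurable κ) (tu : ℝ)
    (j : Fin m) : Measurable (looLevel κ tu j) :=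
  hκ.comp (by
    refine measurable_pi_lambda _ fun i => ?_
    by_cases h : i = Sum.inr j
    · subst h; simp
    · simpa [Function.update_of_ne h] using measurable_pi_apply i)

variable {ν}

lemma integrable_of_measurable_of_le {F : (Fin n ⊕ Fin m → ℝ × ℝ) → ℝ} (hF : Measurable F)
    (C : ℝ) (hC : ∀ z, |F z| ≤ C) : Integrable F (sampleLaw n m ν) :=
  Integrable.of_bound hF.aestronglyMeasurable C (Filter.Eventually.of_forall hC)

/-- Exchanging the test point `j` with each calibration point bounds the mean of `looTerm`. -/
theorem abs_integral_looTerm_le {α : ℝ} (hα : α ∈ Ioo (0 : ℝ) 1)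
    {κ : (Fin n ⊕ Fin m → ℝ) → ℕ} (hκ : Measurable κ) (tu : ℝ) (j : Fin m)
    (hinj : ∀ᵐ z ∂(sampleLaw n m ν), Function.Injective (fsts z)) :
    |∫ z, looTerm α j (fsts z) (snds z) (looLevel κ tu j (snds z)) ∂(sampleLaw n m ν)| ≤
      ∫ z, looCost α j (fsts z) (snds z) (looLevel κ tu j (snds z))
        (fun k => looLevel κ tu j (snds z ∘ exch k j)) ∂(sampleLaw n m ν) := by
  set π := sampleLaw n m ν with hπ
  have hR := measurable_fsts (n := n) (m := m)
  have hT := measurable_snds (n := n) (m := m)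
  have ha : Measurable fun z : Fin n ⊕ Fin m → ℝ × ℝ => looLevel κ tu j (snds z) :=
    (measurable_looLevel hκ tu j).comp hT
  have hTσ : ∀ k : Fin n, Measurable fun z : Fin n ⊕ Fin m → ℝ × ℝ => snds z ∘ exch k j :=
    fun k => by unfold snds; fun_prop
  have hb : ∀ k : Fin n, Measurable fun z : Fin n ⊕ Fin m → ℝ × ℝ =>
      looLevel κ tu j (snds z ∘ exch k j) := fun k => (measurable_looLevel hκ tu j).comp (hTσ k)
  set a : (Fin n ⊕ Fin m → ℝ × ℝ) → ℕ := fun z => looLevel κ tu j (snds z) with ha_def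
  set b : Fin n → (Fin n ⊕ Fin m → ℝ × ℝ) → ℕ := fun k z =>
    looLevel κ tu j (snds z ∘ exch k j) with hb_def
  set A : Fin n → (Fin n ⊕ Fin m → ℝ × ℝ) → ℝ := fun k z => pairWeight j (snds z) (a z) k with hA
  set A' : Fin n → (Fin n ⊕ Fin m → ℝ × ℝ) → ℝ := fun k z => pairWeight j (snds z) (b k z) k
    with hA'
  set x : Fin n ⊕ Fin m → (Fin n ⊕ Fin m → ℝ × ℝ) → ℝ := fun i z =>
    exceeds α (fsts z) (poolSel j (snds z) (a z)) i with hx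
  set x' : Fin n → (Fin n ⊕ Fin m → ℝ × ℝ) → ℝ := fun k z =>
    exceeds α (fsts z) (poolSel j (snds z) (b k z)) (Sum.inl k) with hx'
  -- The exchange is an involution: performed again, it turns the exchanged level back into the
  -- original one.
  have hbb : ∀ k z, b k (z ∘ exch k j) = a z := by
    intro k z
    simp only [hb_def, ha_def]
    congr 1
    ext i
    simp [snds, Function.comp]
  have hAm : ∀ k, Measurable (A k) := fun k => measurable_pairWeight hT ha j k
  have hAm' : ∀ k, Measurable (A' k) := fun k => measurable_pairWeight hT (hb k) j k
  have hxm : ∀ i, Measurable (x i) := fun i => measurable_exceeds α hR hT ha j i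
  have hxm' : ∀ k, Measurable (x' k) := fun k => measurable_exceeds α hR hT (hb k) j _
  have hAσ : ∀ k z, A k (z ∘ exch k j) = A' k z := fun k z =>
    pairWeight_comp_exch j (snds z) (b k z) k
  have hAσ' : ∀ k z, A' k (z ∘ exch k j) = A k z := by
    intro k z
    have h : A' k (z ∘ exch k j) = pairWeight j (snds z) (b k (z ∘ exch k j)) k :=
      pairWeight_comp_exch j (snds z) (b k (z ∘ exch k j)) k
    rw [h, hbb]
  have hxσ : ∀ k z, x (Sum.inr j) (z ∘ exch k j) = x' k z := by
    intro k z
    have h := exceeds_poolSel_comp_exch α k j (fsts z) (snds z) (b k z) (Sum.inr j)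
    rw [exch, Equiv.swap_apply_right] at h
    exact h
  have hA0 : ∀ k z, 0 ≤ A k z := fun k z => pairWeight_nonneg _ _ _ _
  have hA1 : ∀ k z, A k z ≤ 1 := fun k z => pairWeight_le_one _ _ _ _
  have hA0' : ∀ k z, 0 ≤ A' k z := fun k z => pairWeight_nonneg _ _ _ _
  have hA1' : ∀ k z, A' k z ≤ 1 := fun k z => pairWeight_le_one _ _ _ _
  have hx0 : ∀ i z, 0 ≤ x i z := fun i z => exceeds_nonneg _ _ _ _
  have hx1 : ∀ i z, x i z ≤ 1 := fun i z => exceeds_le_one _ _ _ _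
  have hx0' : ∀ k z, 0 ≤ x' k z := fun i z => exceeds_nonneg _ _ _ _
  have hx1' : ∀ k z, x' k z ≤ 1 := fun i z => exceeds_le_one _ _ _ _
  have hiAx : ∀ k i, Integrable (fun z => A k z * x i z) π := fun k i =>
    integrable_of_measurable_of_le ((hAm k).mul (hxm i)) 1 fun z => by
      rw [abs_of_nonneg (mul_nonneg (hA0 _ _) (hx0 _ _))]
      exact mul_le_one₀ (hA1 _ _) (hx0 _ _) (hx1 _ _)
  have hiAx' : ∀ k, Integrable (fun z => A' k z * x' k z) π := fun k =>
    integrable_of_measurable_of_le ((hAm' k).mul (hxm' k)) 1 fun z => by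
      rw [abs_of_nonneg (mul_nonneg (hA0' _ _) (hx0' _ _))]
      exact mul_le_one₀ (hA1' _ _) (hx0' _ _) (hx1' _ _)
  have hid : ∀ k, Integrable (fun z => max (A k z - A' k z) 0) π := fun k =>
    integrable_of_measurable_of_le (((hAm k).sub (hAm' k)).max measurable_const) 1 fun z => by
      rw [abs_of_nonneg (le_max_right _ _)]
      exact max_le (by linarith [hA1 k z, hA0' k z]) zero_le_one
  have hid' : ∀ k, Integrable (fun z => max (A' k z - A k z) 0) π := fun k =>
    integrable_of_measurable_of_le (((hAm' k).sub (hAm k)).max measurable_const) 1 fun z => by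
      rw [abs_of_nonneg (le_max_right _ _)]
      exact max_le (by linarith [hA1' k z, hA0 k z]) zero_le_one
  set y : Fin n → (Fin n ⊕ Fin m → ℝ × ℝ) → ℝ := fun k z =>
    if A' k z ≠ 0 ∧ x' k z ≠ x (Sum.inl k) z then A k z else 0 with hy
  have hym : ∀ k, Measurable (y k) := fun k => Measurable.ite
    ((measurableSet_eq_fun (hAm' k) measurable_const).compl.inter
      (measurableSet_eq_fun (hxm' k) (hxm _)).compl) (hAm k) measurable_const
  have hiy : ∀ k, Integrable (y k) π := fun k =>
    integrable_of_measurable_of_le (hym k) 1 fun z => by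
      simp only [hy]
      split_ifs
      · rw [abs_of_nonneg (hA0 _ _)]; exact hA1 _ _
      · simp
  -- Exchanging `j` and `k` replaces `A x_j` by `A' x'_k`, so the mean compares two quantities
  -- attached to the same calibration point `k` at the levels `b` and `a`.
  have hpair : ∀ k, |∫ z, A k z * (x (Sum.inr j) z - x (Sum.inl k) z) ∂π| ≤
      ∫ z, exchCost α j (fsts z) (snds z) (a z) (b k z) k ∂π := by
    intro k
    have h1 : ∫ z, A k z * (x (Sum.inr j) z - x (Sum.inl k) z) ∂π =
        ∫ z, (A' k z * x' k z - A k z * x (Sum.inl k) z) ∂π := by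
      simp only [mul_sub]
      rw [integral_sub (hiAx _ _) (hiAx _ _), integral_sub (hiAx' _) (hiAx _ _),
        ← integral_comp_perm ν (exch k j) fun z => A k z * x (Sum.inr j) z]
      simp only [hAσ, hxσ]
      rfl
    -- The exchange swaps `A` and `A'`, so gains and losses of weight have equal means. This gives
    -- the factor 2 in `exchCost` and is why bounding losses alone suffices.
    have h2 : ∫ z, max (A' k z - A k z) 0 ∂π = ∫ z, max (A k z - A' k z) 0 ∂π := by
      rw [hπ, ← integral_comp_perm ν (exch k j) fun z => max (A k z - A' k z) 0]
      simp only [hAσ, hAσ']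
    have h3 : ∫ z, exchCost α j (fsts z) (snds z) (a z) (b k z) k ∂π =
        ∫ z, (max (A k z - A' k z) 0 + max (A' k z - A k z) 0 + y k z) ∂π := by
      have e1 : ∫ z, (max (A k z - A' k z) 0 + max (A' k z - A k z) 0 + y k z) ∂π =
          ∫ z, (max (A k z - A' k z) 0 + max (A' k z - A k z) 0) ∂π + ∫ z, y k z ∂π :=
        integral_add ((hid k).add (hid' k)) (hiy k)
      rw [e1, integral_add (hid k) (hid' k), h2,
        ← two_mul, ← integral_const_mul, ← integral_add ((hid k).const_mul 2) (hiy k)]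
      rfl
    rw [h1, h3]
    refine abs_integral_le_integral_abs.trans
      (integral_mono ((hiAx' k).sub (hiAx _ _)).abs (((hid k).add (hid' k)).add (hiy k)) ?_)
    intro z
    have e0 := hA0 k z
    have e1 := hA0' k z
    have e2 := hx0 (Sum.inl k) z
    have e3 := hx1 (Sum.inl k) z
    have e4 := hx0' k z
    have e5 := hx1' k z
    simp only [hy]
    have m1 := le_max_left (A k z - A' k z) 0
    have m2 := le_max_right (A k z - A' k z) 0
    have m3 := le_max_left (A' k z - A k z) 0
    have m4 := le_max_right (A' k z - A k z) 0
    split_ifs with h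
    · rw [abs_le]
      constructor <;> nlinarith
    · rw [add_zero]
      by_cases h0 : A' k z = 0
      · rw [h0] at m1 m2 m3 m4 ⊢
        rw [abs_le]
        constructor <;> nlinarith
      · have : x' k z = x (Sum.inl k) z := by
          by_contra hne; exact h ⟨h0, hne⟩
        rw [this, abs_le]
        constructor <;> nlinarith
  have hiAxx : ∀ k, Integrable (fun z => A k z * (x (Sum.inr j) z - x (Sum.inl k) z)) π := by
    intro k
    simp only [mul_sub]
    exact (hiAx _ _).sub (hiAx _ _)
  have hself : Integrable (fun z => selfWeight j (snds z) (a z)) π :=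
    integrable_of_measurable_of_le (measurable_selfWeight hT ha j) 1 fun z => by
      rw [abs_of_nonneg (selfWeight_nonneg _ _ _)]
      exact (selfWeight_le _ _ _).trans (Nat.cast_inv_le_one _)
  have hterm : Integrable (fun z => looTerm α j (fsts z) (snds z) (a z)) π :=
    integrable_of_measurable_of_le (measurable_looTerm α hR hT ha j) 1 fun z =>
      (abs_looTerm_le hα _ _ _ _).trans (Nat.cast_inv_le_one _)
  have hcost : ∀ k, Integrable (fun z => exchCost α j (fsts z) (snds z) (a z) (b k z) k) π :=
    fun k => ((hid k).const_mul 2).add (hiy k)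
  have hdiff : |∫ z, looTerm α j (fsts z) (snds z) (a z) ∂π -
      ∑ k, ∫ z, A k z * (x (Sum.inr j) z - x (Sum.inl k) z) ∂π| ≤
      ∫ z, selfWeight j (snds z) (a z) ∂π := by
    rw [← integral_finsetSum _ fun k _ => hiAxx k,
      ← integral_sub hterm (integrable_finsetSum _ fun k _ => hiAxx k)]
    refine abs_integral_le_integral_abs.trans (integral_mono_ae
      (hterm.sub (integrable_finsetSum _ fun k _ => hiAxx k)).abs hself ?_)
    filter_upwards [hinj] with z hz
    exact looTerm_sub_sum_le hα j hz (snds z) (a z)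
  have hsum : |∑ k, ∫ z, A k z * (x (Sum.inr j) z - x (Sum.inl k) z) ∂π| ≤
      ∑ k, ∫ z, exchCost α j (fsts z) (snds z) (a z) (b k z) k ∂π :=
    (Finset.abs_sum_le_sum_abs _ _).trans (Finset.sum_le_sum fun k _ => hpair k)
  have hfin : ∫ z, looCost α j (fsts z) (snds z) (a z) (fun k => b k z) ∂π =
      ∫ z, selfWeight j (snds z) (a z) ∂π +
      ∑ k, ∫ z, exchCost α j (fsts z) (snds z) (a z) (b k z) k ∂π := by
    rw [← integral_finsetSum _ fun k _ => hcost k,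
      ← integral_add hself (integrable_finsetSum _ fun k _ => hcost k)]
    rfl
  rw [hfin]
  have := abs_add_le (∫ z, looTerm α j (fsts z) (snds z) (a z) ∂π -
      ∑ k, ∫ z, A k z * (x (Sum.inr j) z - x (Sum.inl k) z) ∂π)
      (∑ k, ∫ z, A k z * (x (Sum.inr j) z - x (Sum.inl k) z) ∂π)
  rw [sub_add_cancel] at this
  linarith

end

end SCOP

/-! ### Inverse moment of the number of low calibration scores -/

namespace SCOP

noncomputable section

variable {n m : ℕ}

/-- The number of calibration scores with fewer than `r` test scores below them. -/
def calBelow (r : ℕ) (T : Fin n ⊕ Fin m → ℝ) : ℕ :=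
  (Finset.univ.filter fun k : Fin n => testRank T (Sum.inl k) < r).card

lemma card_testRank_lt {T : Fin n ⊕ Fin m → ℝ} (hT : Function.Injective T) {r : ℕ} (hr : r ≤ m) :
    (Finset.univ.filter fun l : Fin m => testRank T (Sum.inr l) < r).card = r := by
  have h := card_filter_rankIn (S := Finset.univ) (v := fun l : Fin m => T (Sum.inr l))
    (hT.comp Sum.inr_injective).injOn (fun x => x < r)
  simp only [Finset.card_univ, Fintype.card_fin] at h
  refine Eq.trans h ?_
  have : (Finset.range m).filter (fun x => x < r) = Finset.range r := by
    ext x; simp; omega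
  rw [this, Finset.card_range]

lemma card_testRank_window {T : Fin n ⊕ Fin m → ℝ} (hT : Function.Injective T) (a b : ℕ) :
    (Finset.univ.filter fun l : Fin m => a ≤ testRank T (Sum.inr l) ∧
      testRank T (Sum.inr l) < b).card ≤ b - a := by
  exact card_filter_rankIn_window (hT.comp Sum.inr_injective).injOn a b

/-- After the exchange the point `l` carries the score of `i`, which is not below that of `l`; no
other test score moves, so the count is the same. -/
lemma testRank_exch_inl {T : Fin n ⊕ Fin m → ℝ} {i : Fin n} {l : Fin m}
    (h : testRank T (Sum.inr l) < testRank T (Sum.inl i)) :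
    testRank (T ∘ exch i l) (Sum.inl i) = testRank T (Sum.inr l) := by
  have hlt : ¬ T (Sum.inl i) < T (Sum.inr l) := fun h' =>
    absurd (testRank_mono h'.le) (not_le.2 h)
  rw [testRank_eq_looRank_add l, looRank_comp_exch]
  simp only [Function.comp, exch, Equiv.swap_apply_left, Equiv.swap_apply_right, looRank_self,
    if_neg hlt, add_zero]

/-- Changing one test score moves the rank of every other calibration point by at most one, whence
`r + 1`; the summand `1` accounts for `i` itself. -/
lemma calBelow_exch_le (T : Fin n ⊕ Fin m → ℝ) (i : Fin n) (l : Fin m) (r : ℕ) :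
    calBelow r (T ∘ exch i l) ≤ calBelow (r + 1) T + 1 := by
  classical
  unfold calBelow
  refine le_trans (Finset.card_le_card ?_) (Finset.card_insert_le i _)
  intro k hk
  simp only [Finset.mem_filter, Finset.mem_insert, Finset.mem_univ, true_and] at hk ⊢
  by_cases hki : k = i
  · exact Or.inl hki
  · right
    have h1 := testRank_eq_looRank_add l (T ∘ exch i l) (Sum.inl k)
    have h0 : exch i l (Sum.inl k) = Sum.inl k :=
      Equiv.swap_apply_of_ne_of_ne (by simpa using hki) (by simp)
    rw [looRank_comp_exch, h0] at h1
    have h2 := testRank_eq_looRank_add l T (Sum.inl k)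
    have h3 : (if T (Sum.inr l) < T (Sum.inl k) then 1 else 0) ≤ 1 := by split_ifs <;> simp
    omega

lemma measurable_calBelow {Z : Type*} [MeasurableSpace Z] {T : Z → Fin n ⊕ Fin m → ℝ}
    (hT : Measurable T) (r : ℕ) : Measurable fun z => calBelow r (T z) :=
  measurable_card_filter _ fun _ => measurableSet_lt (measurable_testRank hT _) measurable_const

variable {ν : Measure (ℝ × ℝ)} [IsProbabilityMeasure ν]

/-- The mean of `1 / (N + 1)`, where `N` is the number of calibration scores below the
`(r + 1)`-th smallest test score. -/
theorem integral_inv_calBelow_le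
    (hinj : ∀ᵐ z ∂(sampleLaw n m ν), Function.Injective (snds z)) {r : ℕ} (hr : r ≤ m) :
    (r : ℝ) * ((n + 1) * ∫ z, ((calBelow (r + 1) (snds z) : ℝ) + 1)⁻¹ ∂(sampleLaw n m ν)) ≤
      m + r := by
  set π := sampleLaw n m ν with hπ
  have hT := measurable_snds (n := n) (m := m)
  have hcast : Measurable fun x : ℕ => (x : ℝ) := Measurable.of_discrete
  set N : (Fin n ⊕ Fin m → ℝ × ℝ) → ℝ := fun z => (calBelow (r + 1) (snds z) : ℝ) with hN
  set N' : (Fin n ⊕ Fin m → ℝ × ℝ) → ℝ := fun z => (calBelow r (snds z) : ℝ) with hN'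
  have hN0 : ∀ z, 0 ≤ N z := fun z => Nat.cast_nonneg _
  have hNm : Measurable N := hcast.comp (measurable_calBelow hT _)
  have hNm' : Measurable N' := hcast.comp (measurable_calBelow hT _)
  -- Double counting over pairs of a low test point `l` and a high calibration point `i`. There are
  -- `r (n - N)` such pairs, so the total is `r ((n + 1) / (N + 1) - 1)`.
  set f : Fin n → Fin m → (Fin n ⊕ Fin m → ℝ × ℝ) → ℝ := fun i l z =>
    if testRank (snds z) (Sum.inr l) < r ∧ r + 1 ≤ testRank (snds z) (Sum.inl i) then
      (N z + 1)⁻¹ else 0 with hf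
  set g : Fin n → (Fin n ⊕ Fin m → ℝ × ℝ) → ℝ := fun i z =>
    if testRank (snds z) (Sum.inl i) < r then (N' z)⁻¹ else 0 with hg
  -- The exchange makes `i` one of the low calibration points, and there are then at most `N + 1` of
  -- them.
  have hfg : ∀ i l z, f i l z ≤ g i (z ∘ exch i l) := by
    intro i l z
    simp only [hf]
    split_ifs with h
    · have h1 : testRank (snds (z ∘ exch i l)) (Sum.inl i) = testRank (snds z) (Sum.inr l) :=
        testRank_exch_inl (T := snds z) (by omega)
      have h2 : calBelow r (snds (z ∘ exch i l)) ≤ calBelow (r + 1) (snds z) + 1 :=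
        calBelow_exch_le (snds z) i l r
      have h3 : 0 < calBelow r (snds (z ∘ exch i l)) :=
        Finset.card_pos.2 ⟨i, by simp only [Finset.mem_filter, Finset.mem_univ, true_and]; omega⟩
      simp only [hg]
      rw [if_pos (by omega)]
      refine inv_anti₀ (by simp only [hN']; exact_mod_cast h3) ?_
      simp only [hN, hN']
      exact_mod_cast h2
    · simp only [hg]
      split_ifs <;> positivity
  have hgm : ∀ i, Measurable (g i) := fun i => Measurable.ite
    (measurableSet_lt (measurable_testRank hT _) measurable_const) hNm'.inv measurable_const
  have hfm : ∀ i l, Measurable (f i l) := fun i l => Measurable.ite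
    ((measurableSet_lt (measurable_testRank hT _) measurable_const).inter
      (measurableSet_le measurable_const (measurable_testRank hT _)))
    (hNm.add_const 1).inv measurable_const
  have hinv1 : ∀ z, (N z + 1)⁻¹ ≤ 1 := fun z => inv_le_one_of_one_le₀ (by linarith [hN0 z])
  have hinv0 : ∀ z, 0 ≤ (N z + 1)⁻¹ := fun z => by have := hN0 z; positivity
  have hfi : ∀ i l, Integrable (f i l) π := fun i l =>
    integrable_of_measurable_of_le (hfm i l) 1 fun z => by
      simp only [hf]
      split_ifs
      · rw [abs_of_nonneg (hinv0 z)]; exact hinv1 z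
      · simp
  have hgb : ∀ i z, |g i z| ≤ 1 := fun i z => by
      simp only [hg]
      split_ifs
      · rw [abs_of_nonneg (by positivity)]; exact Nat.cast_inv_le_one _
      · simp
  have hgi : ∀ i, Integrable (g i) π := fun i =>
    integrable_of_measurable_of_le (hgm i) 1 (hgb i)
  -- Each of the `N'` low calibration points receives `1 / N'`; the total is `0` when there are
  -- none.
  have hgsum : ∀ z, ∑ i, g i z ≤ 1 := by
    intro z
    simp only [hg]
    rw [← Finset.sum_filter, Finset.sum_const, nsmul_eq_mul]
    exact mul_inv_le_one
  have hfint : ∀ i l, ∫ z, f i l z ∂π ≤ ∫ z, g i z ∂π := by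
    intro i l
    rw [hπ, ← integral_comp_perm ν (exch i l) (g i)]
    refine integral_mono (hfi i l) ?_ (hfg i l)
    exact integrable_of_measurable_of_le ((hgm i).comp
      (measurePreserving_comp_perm ν (exch i l)).measurable) 1 fun z => hgb i _
  have hsumle : ∑ i, ∑ l, ∫ z, f i l z ∂π ≤ m := by
    calc ∑ i, ∑ l, ∫ z, f i l z ∂π ≤ ∑ i : Fin n, ∑ _l : Fin m, ∫ z, g i z ∂π :=
          Finset.sum_le_sum fun i _ => Finset.sum_le_sum fun l _ => hfint i l
      _ = m * ∫ z, ∑ i, g i z ∂π := by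
          rw [integral_finsetSum _ fun i _ => hgi i]
          simp only [Finset.sum_const, Finset.card_univ, Fintype.card_fin, nsmul_eq_mul,
            Finset.mul_sum]
      _ ≤ m * 1 := by
          refine mul_le_mul_of_nonneg_left ?_ (Nat.cast_nonneg _)
          have h := integral_mono (integrable_finsetSum _ fun i _ => hgi i)
            (integrable_const (μ := π) (1 : ℝ)) hgsum
          simpa using h
      _ = m := mul_one _
  have hsumeq : ∑ i, ∑ l, ∫ z, f i l z ∂π = ∫ z, (r : ℝ) * ((n + 1) * (N z + 1)⁻¹ - 1) ∂π := by
    simp only [← integral_finsetSum _ fun l _ => hfi _ l]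
    rw [← integral_finsetSum _ fun i _ => integrable_finsetSum _ fun l _ => hfi i l]
    refine integral_congr_ae ?_
    filter_upwards [hinj] with z hz
    have h1 : ∀ i, ∑ l, f i l z = if r + 1 ≤ testRank (snds z) (Sum.inl i) then
        (r : ℝ) * (N z + 1)⁻¹ else 0 := by
      intro i
      simp only [hf]
      split_ifs with h
      · simp only [h, and_true]
        rw [← Finset.sum_filter, Finset.sum_const, card_testRank_lt hz hr, nsmul_eq_mul]
      · simp [h]
    simp only [h1]
    rw [← Finset.sum_filter, Finset.sum_const, nsmul_eq_mul]
    have h2 := Finset.card_filter_add_card_filter_not (s := (Finset.univ : Finset (Fin n)))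
      (fun i => testRank (snds z) (Sum.inl i) < r + 1)
    simp only [not_lt, Finset.card_univ, Fintype.card_fin] at h2
    have h3 : N z + ((Finset.univ.filter fun i : Fin n =>
        r + 1 ≤ testRank (snds z) (Sum.inl i)).card : ℝ) = n := by
      simp only [hN, calBelow]
      exact_mod_cast h2
    have h4 : N z + 1 ≠ 0 := by have := hN0 z; positivity
    rw [eq_sub_of_add_eq' h3]
    field_simp
    ring
  have hNi : Integrable (fun z => (N z + 1)⁻¹) π :=
    integrable_of_measurable_of_le (hNm.add_const 1).inv 1 fun z => by
      rw [abs_of_nonneg (hinv0 z)]; exact hinv1 z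
  rw [hsumeq, integral_const_mul, integral_sub (hNi.const_mul _) (integrable_const _),
    integral_const_mul] at hsumle
  simp only [integral_const, probReal_univ, smul_eq_mul, mul_one] at hsumle
  linarith

end

end SCOP

/-! ### Chernoff bounds, uniformity of the distribution function, rank windows -/

namespace SCOP

noncomputable section

variable {n m : ℕ} {ν : Measure (ℝ × ℝ)} [IsProbabilityMeasure ν]

/-- By independence the mean is a product of factors `1 + p (e^s - 1)`, with `p = ν.real B`, each at
most `exp (p (e^s - 1))`. -/
lemma integral_exp_card_le (I : Finset (Fin n ⊕ Fin m)) {B : Set (ℝ × ℝ)}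
    [DecidablePred (· ∈ B)] (hB : MeasurableSet B) (s : ℝ) :
    ∫ z, Real.exp (s * (I.filter fun i => z i ∈ B).card) ∂(sampleLaw n m ν) ≤
      Real.exp (I.card * (ν.real B * (Real.exp s - 1))) := by
  have h1 : ∀ z : Fin n ⊕ Fin m → ℝ × ℝ, Real.exp (s * (I.filter fun i => z i ∈ B).card) =
      ∏ i, (if i ∈ I then 1 + B.indicator (fun _ => Real.exp s - 1) (z i) else 1) := by
    intro z
    rw [mul_comm, Real.exp_nat_mul, Finset.prod_ite_mem, Finset.univ_inter,
      Finset.card_filter, ← Finset.prod_pow_eq_pow_sum]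
    refine Finset.prod_congr rfl fun i _ => ?_
    by_cases h : z i ∈ B <;> simp [h]
  simp only [h1]
  rw [integral_fintype_prod_eq_prod (fun i (x : ℝ × ℝ) =>
    if i ∈ I then 1 + B.indicator (fun _ => Real.exp s - 1) x else 1)]
  have h2 : ∀ i : Fin n ⊕ Fin m, ∫ x, (if i ∈ I then
      1 + B.indicator (fun _ => Real.exp s - 1) x else 1) ∂ν =
      if i ∈ I then 1 + ν.real B * (Real.exp s - 1) else 1 := by
    intro i
    split_ifs
    · rw [integral_add (integrable_const _) ((integrable_const _).indicator hB),
        integral_indicator_const _ hB]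
      simp
    · simp
  simp only [h2]
  rw [Finset.prod_ite_mem, Finset.univ_inter, Finset.prod_const, Real.exp_nat_mul]
  have h3 : ν.real B ≤ 1 := measureReal_le_one
  have h4 : 0 ≤ ν.real B := measureReal_nonneg
  refine pow_le_pow_left₀ ?_ ?_ _
  · nlinarith [Real.exp_pos s]
  · linarith [Real.add_one_le_exp (ν.real B * (Real.exp s - 1))]

lemma measurable_card_mem (I : Finset (Fin n ⊕ Fin m)) {B : Set (ℝ × ℝ)}
    [DecidablePred (· ∈ B)] (hB : MeasurableSet B) :
    Measurable fun z : Fin n ⊕ Fin m → ℝ × ℝ => ((I.filter fun i => z i ∈ B).card : ℝ) :=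
  (Measurable.of_discrete (f := fun x : ℕ => (x : ℝ))).comp
    (measurable_card_filter _ fun i => measurable_pi_apply i hB)

lemma integrable_exp_card (I : Finset (Fin n ⊕ Fin m)) {B : Set (ℝ × ℝ)}
    [DecidablePred (· ∈ B)] (hB : MeasurableSet B) (s : ℝ) :
    Integrable (fun z => Real.exp (s * (I.filter fun i => z i ∈ B).card)) (sampleLaw n m ν) :=
  integrable_of_measurable_of_le ((measurable_card_mem I hB).const_mul s).exp
    (Real.exp (|s| * I.card)) fun z => by
      rw [abs_of_nonneg (Real.exp_pos _).le, Real.exp_le_exp]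
      refine mul_le_mul (le_abs_self s) ?_ (Nat.cast_nonneg _) (abs_nonneg s)
      exact_mod_cast Finset.card_filter_le _ _

/-- Chernoff at `s = 1`: with mean `μ`, the exponent `-4μ + (e - 1)μ` is at most `-2μ` because `e <
3`. -/
lemma measureReal_card_ge_le (I : Finset (Fin n ⊕ Fin m)) {B : Set (ℝ × ℝ)}
    [DecidablePred (· ∈ B)] (hB : MeasurableSet B) :
    (sampleLaw n m ν).real {z | 4 * (I.card * ν.real B) ≤ ((I.filter fun i => z i ∈ B).card : ℝ)} ≤
      Real.exp (-(2 * (I.card * ν.real B))) := by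
  refine (measure_ge_le_exp_mul_mgf _ zero_le_one (integrable_exp_card I hB 1)).trans ?_
  refine (mul_le_mul_of_nonneg_left (integral_exp_card_le I hB 1) (Real.exp_pos _).le).trans ?_
  rw [← Real.exp_add, Real.exp_le_exp]
  have h0 : 0 ≤ I.card * ν.real B := by positivity
  have := Real.exp_one_lt_d9
  nlinarith

/-- Chernoff at `s = -1`, with `1 - 1/e ≥ 1/2`. -/
lemma measureReal_card_le_le (I : Finset (Fin n ⊕ Fin m)) {B : Set (ℝ × ℝ)}
    [DecidablePred (· ∈ B)] (hB : MeasurableSet B) (q : ℝ) :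
    (sampleLaw n m ν).real {z | ((I.filter fun i => z i ∈ B).card : ℝ) ≤ q} ≤
      Real.exp (q - I.card * ν.real B / 2) := by
  refine (measure_le_le_exp_mul_mgf (t := -1) _ (by norm_num)
    (integrable_exp_card I hB (-1))).trans ?_
  refine (mul_le_mul_of_nonneg_left (integral_exp_card_le I hB (-1)) (Real.exp_pos _).le).trans ?_
  rw [← Real.exp_add, Real.exp_le_exp]
  have h0 : 0 ≤ I.card * ν.real B := by positivity
  have h1 : Real.exp (-1) ≤ 1 / 2 := by
    rw [Real.exp_neg, ← one_div]
    have := Real.exp_one_gt_d9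
    exact one_div_le_one_div_of_le (by norm_num) (by linarith)
  nlinarith

lemma continuous_cdf (τ : Measure ℝ) [IsProbabilityMeasure τ] [NullSingletonClass τ] :
    Continuous (cdf τ) := by
  rw [continuous_iff_continuousAt]
  intro a
  rw [(monotone_cdf τ).continuousAt_iff_leftLim_eq_rightLim, StieltjesFunction.rightLim_eq]
  have h := (cdf τ).measure_singleton a
  rw [measure_cdf, measure_singleton, eq_comm, ENNReal.ofReal_eq_zero] at h
  exact le_antisymm ((monotone_cdf τ).leftLim_le le_rfl) (by linarith)

lemma exists_cdf_eq (τ : Measure ℝ) [IsProbabilityMeasure τ] [NullSingletonClass τ] {u : ℝ}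
    (hu : u ∈ Ioo (0 : ℝ) 1) : ∃ x, cdf τ x = u := by
  refine mem_range_of_exists_le_of_exists_ge (continuous_cdf τ) ?_ ?_
  · exact (((tendsto_cdf_atBot τ).eventually (gt_mem_nhds hu.1)).exists).imp fun _ h => h.le
  · exact (((tendsto_cdf_atTop τ).eventually (lt_mem_nhds hu.2)).exists).imp fun _ h => h.le

/-- The distribution function of an atomless law, evaluated at a variable with this law, is
uniformly distributed. -/
lemma measureReal_cdf_lt (τ : Measure ℝ) [IsProbabilityMeasure τ] [NullSingletonClass τ] {u : ℝ}
    (hu : u ∈ Icc (0 : ℝ) 1) : τ.real {t | cdf τ t < u} = u := by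
  refine le_antisymm ?_ (le_of_forall_lt fun v hv => ?_)
  · rcases hu.2.eq_or_lt with h1 | h1
    · rw [h1]; exact measureReal_le_one
    rcases hu.1.eq_or_lt with h0 | h0
    · have : {t | cdf τ t < u} = ∅ := by
        ext t; simp [← h0, cdf_nonneg τ t]
      rw [this, ← h0]; simp
    obtain ⟨x, hx⟩ := exists_cdf_eq τ ⟨h0, h1⟩
    calc τ.real {t | cdf τ t < u} ≤ τ.real (Iic x) := by
          refine measureReal_mono fun t ht => ?_
          by_contra hlt
          have := (monotone_cdf τ) (not_le.1 hlt).le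
          rw [hx] at this
          exact absurd ht (not_lt.2 this)
      _ = u := by rw [← cdf_eq_real, hx]
  · rcases lt_or_ge v 0 with hv0 | hv0
    · exact hv0.trans_le measureReal_nonneg
    obtain ⟨w, hw1, hw2⟩ := exists_between hv
    obtain ⟨x, hx⟩ := exists_cdf_eq τ (u := w) ⟨hv0.trans_lt hw1, hw2.trans_le hu.2⟩
    calc v < w := hw1
      _ = τ.real (Iic x) := by rw [← cdf_eq_real, hx]
      _ ≤ τ.real {t | cdf τ t < u} := measureReal_mono fun t ht =>
          ((monotone_cdf τ) ht).trans_lt (by rw [hx]; exact hw2)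

/-- A tie between two independent variables is the diagonal under a product law, whose sections are
null points. Thus residuals and scores are almost surely without ties. -/
lemma ae_injective_comp {φ : ℝ × ℝ → ℝ} (hφ : Measurable φ) (h0 : ∀ c, ν {x | φ x = c} = 0) :
    ∀ᵐ z ∂(sampleLaw n m ν), Function.Injective fun i => φ (z i) := by
  have h : ∀ i l : Fin n ⊕ Fin m, i ≠ l → ∀ᵐ z ∂(sampleLaw n m ν), φ (z i) ≠ φ (z l) := by
    intro i l hil
    have hind := iIndepFun_pi (μ := fun _ : Fin n ⊕ Fin m => ν) (X := fun _ => φ)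
      (fun _ => hφ.aemeasurable)
    have hm : ∀ i : Fin n ⊕ Fin m, Measurable fun z : Fin n ⊕ Fin m → ℝ × ℝ => φ (z i) :=
      fun i => hφ.comp (measurable_pi_apply i)
    have hp := (indepFun_iff_map_prod_eq_prod_map_map (hm i).aemeasurable
      (hm l).aemeasurable).1
      (hind.indepFun hil)
    have hs : MeasurableSet {p : ℝ × ℝ | p.1 = p.2} :=
      measurableSet_eq_fun measurable_fst measurable_snd
    have hz : (sampleLaw n m ν).map (fun z => (φ (z i), φ (z l))) {p : ℝ × ℝ | p.1 = p.2} = 0 := by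
      rw [hp, Measure.measure_prod_null hs]
      refine Filter.Eventually.of_forall fun x => ?_
      have : Prod.mk x ⁻¹' {p : ℝ × ℝ | p.1 = p.2} = {x} := by
        ext y; simp [eq_comm]
      simp only [this, Pi.zero_apply]
      rw [Measure.map_apply (hm l) (measurableSet_singleton x)]
      have := (measurePreserving_eval (fun _ : Fin n ⊕ Fin m => ν) l).measure_preimage
        (hφ (measurableSet_singleton x)).nullMeasurableSet
      exact this.trans (h0 x)
    rw [Measure.map_apply ((hm i).prodMk (hm l)) hs] at hz
    exact measure_eq_zero_iff_ae_notMem.1 hz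
  have h' : ∀ᵐ z ∂(sampleLaw n m ν), ∀ i l : Fin n ⊕ Fin m, i ≠ l → φ (z i) ≠ φ (z l) := by
    rw [ae_all_iff]
    intro i
    rw [ae_all_iff]
    intro l
    by_cases hil : i = l
    · simp [hil]
    · filter_upwards [h i l hil] with z hz _ using hz
  filter_upwards [h'] with z hz i l hil
  by_contra hne
  exact hz i l hne hil

/-- If monotone cells contain many test scores and few calibration scores each, then rank windows
contain few calibration scores. -/
lemma poolWindow_le_of_cells {T : Fin n ⊕ Fin m → ℝ} {cell : Fin n ⊕ Fin m → ℕ} {M q L : ℕ}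
    (hmono : ∀ i l, T i ≤ T l → cell i ≤ cell l) (hlt : ∀ i, cell i < M)
    (htest : ∀ c < M, q < (Finset.univ.filter fun l : Fin m => cell (Sum.inr l) = c).card)
    (hcal : ∀ c < M, (Finset.univ.filter fun k : Fin n => cell (Sum.inl k) = c).card ≤ L)
    (j : Fin m) (x : ℕ) : poolWindow j T q x ≤ 2 * L + 1 := by
  classical
  -- Putting the `j`-th score back raises a rank by at most one, so the window of full test ranks
  -- has length `q + 1`. The point `j` itself gives the final `+ 1`.
  set W := Finset.univ.filter fun k : Fin n =>
    x ≤ testRank T (Sum.inl k) ∧ testRank T (Sum.inl k) < x + (q + 1) with hW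
  have h1 : poolWindow j T q x ≤ W.card + 1 := by
    have hsub : ((pool j).filter fun i => x ≤ looRank j T i ∧ looRank j T i < x + q) ⊆
        insert (Sum.inr j) (W.map ⟨Sum.inl, Sum.inl_injective⟩) := by
      intro i hi
      simp only [Finset.mem_filter, pool, Finset.mem_insert, Finset.mem_map, Finset.mem_univ,
        true_and, Function.Embedding.coeFn_mk] at hi ⊢
      rcases hi with ⟨hi | ⟨k, rfl⟩, h2⟩
      · exact Or.inl hi
      · refine Or.inr ⟨k, ?_, rfl⟩
        have h3 := testRank_eq_looRank_add j T (Sum.inl k)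
        have h4 : (if T (Sum.inr j) < T (Sum.inl k) then 1 else 0) ≤ 1 := by split_ifs <;> simp
        simp only [hW, Finset.mem_filter, Finset.mem_univ, true_and]
        omega
    refine (Finset.card_le_card hsub).trans ((Finset.card_insert_le _ _).trans ?_)
    rw [Finset.card_map]
  refine h1.trans (Nat.add_le_add_right ?_ 1)
  rcases W.eq_empty_or_nonempty with hemp | hne
  · rw [hemp]; simp
  obtain ⟨k0, hk0, hmin⟩ := Finset.exists_min_image W (fun k => cell (Sum.inl k)) hne
  set c := cell (Sum.inl k0) with hc
  -- A point of `W` two or more cells above the lowest one would have all test scores of cell `c +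
  -- 1`, more than `q`, between them, which the window does not allow. So `W` meets at most two
  -- cells.
  have hup : ∀ k ∈ W, cell (Sum.inl k) ≤ c + 1 := by
    intro k hk
    by_contra hgt
    push Not at hgt
    have hcM : c + 1 < M := hgt.trans (hlt _)
    have hT := htest (c + 1) hcM
    simp only [hW, Finset.mem_filter, Finset.mem_univ, true_and] at hk hk0
    have hdisj : Disjoint (Finset.univ.filter fun l : Fin m => T (Sum.inr l) < T (Sum.inl k0))
        (Finset.univ.filter fun l : Fin m => cell (Sum.inr l) = c + 1) := by
      rw [Finset.disjoint_left]
      intro l hl hl'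
      simp only [Finset.mem_filter, Finset.mem_univ, true_and] at hl hl'
      have := hmono _ _ hl.le
      omega
    have hsub : (Finset.univ.filter fun l : Fin m => T (Sum.inr l) < T (Sum.inl k0)) ∪
        (Finset.univ.filter fun l : Fin m => cell (Sum.inr l) = c + 1) ⊆
        Finset.univ.filter fun l : Fin m => T (Sum.inr l) < T (Sum.inl k) := by
      intro l hl
      simp only [Finset.mem_union, Finset.mem_filter, Finset.mem_univ, true_and] at hl ⊢
      by_contra hlt'
      have h5 := hmono _ _ (not_lt.1 hlt')
      rcases hl with hl | hl
      · have h6 := hmono _ _ hl.le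
        omega
      · omega
    have h7 := Finset.card_le_card hsub
    rw [Finset.card_union_of_disjoint hdisj] at h7
    unfold testRank at hk hk0
    omega
  have hWsub : W ⊆ (Finset.univ.filter fun k : Fin n => cell (Sum.inl k) = c) ∪
      (W.filter fun k => cell (Sum.inl k) = c + 1) := by
    intro k hk
    have h1 := hup k hk
    have h2 := hmin k hk
    simp only [Finset.mem_union, Finset.mem_filter, Finset.mem_univ, true_and]
    by_cases h : cell (Sum.inl k) = c
    · exact Or.inl h
    · exact Or.inr ⟨hk, by omega⟩
  have h8 := hcal c (hlt _)
  have h9 : (W.filter fun k => cell (Sum.inl k) = c + 1).card ≤ L := by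
    rcases (W.filter fun k => cell (Sum.inl k) = c + 1).eq_empty_or_nonempty with he | ⟨k, hk⟩
    · rw [he]; simp
    · have hk' := (Finset.mem_filter.1 hk).2
      refine le_trans (Finset.card_le_card ?_) (hcal (c + 1) (hk' ▸ hlt _))
      exact Finset.filter_subset_filter _ (Finset.subset_univ _)
  have h10 := (Finset.card_le_card hWsub).trans (Finset.card_union_le _ _)
  omega

end

end SCOP

/-! ### Crowded rank windows are improbable -/

namespace SCOP

noncomputable section

variable {n m : ℕ} {ν : Measure (ℝ × ℝ)} [IsProbabilityMeasure ν]

lemma measurableSet_poolWindow_le {Z : Type*} [MeasurableSpace Z] {T : Z → Fin n ⊕ Fin m → ℝ}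
    (hT : Measurable T) (q D : ℕ) :
    MeasurableSet {z | ∀ (j : Fin m) (x : ℕ), poolWindow j (T z) q x ≤ D} := by
  have : {z | ∀ (j : Fin m) (x : ℕ), poolWindow j (T z) q x ≤ D} =
      ⋂ (j : Fin m) (x : ℕ), {z | poolWindow j (T z) q x ≤ D} := by
    ext z; simp
  rw [this]
  refine MeasurableSet.iInter fun j => MeasurableSet.iInter fun x => ?_
  refine measurableSet_le (measurable_card_filter _ fun i => ?_) measurable_const
  exact (measurableSet_le measurable_const (measurable_looRank hT j i)).inter
    (measurableSet_lt (measurable_looRank hT j i) measurable_const)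

lemma card_filter_inl (p : Fin n ⊕ Fin m → Prop) [DecidablePred p] :
    ((Finset.univ.map ⟨Sum.inl, Sum.inl_injective⟩ : Finset (Fin n ⊕ Fin m)).filter p).card =
      (Finset.univ.filter fun k : Fin n => p (Sum.inl k)).card := by
  rw [Finset.filter_map, Finset.card_map]
  rfl

lemma card_filter_inr (p : Fin n ⊕ Fin m → Prop) [DecidablePred p] :
    ((Finset.univ.map ⟨Sum.inr, Sum.inr_injective⟩ : Finset (Fin n ⊕ Fin m)).filter p).card =
      (Finset.univ.filter fun k : Fin m => p (Sum.inr k)).card := by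
  rw [Finset.filter_map, Finset.card_map]
  rfl

/-- With high probability, no window of `q` ranks contains many points of a pool. -/
theorem measureReal_poolWindow_gt_le (hν : ∀ c, ν {x | x.2 = c} = 0) {M : ℕ} (hM : 0 < M)
    (q : ℕ) :
    (sampleLaw n m ν).real {z | ∀ (j : Fin m) (x : ℕ),
      poolWindow j (snds z) q x ≤ 2 * ⌊4 * ((n : ℝ) * (M : ℝ)⁻¹)⌋₊ + 1}ᶜ ≤
      M * (Real.exp (-(2 * (n * (M : ℝ)⁻¹))) + Real.exp (q - m * (M : ℝ)⁻¹ / 2)) := by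
  classical
  set τ : Measure ℝ := ν.map Prod.snd with hτ
  have : IsProbabilityMeasure τ := Measure.isProbabilityMeasure_map measurable_snd.aemeasurable
  have : NullSingletonClass τ := ⟨fun c => by
    rw [hτ, Measure.map_apply measurable_snd (measurableSet_singleton c)]
    exact hν c⟩
  have hM' : (0 : ℝ) < M := by exact_mod_cast hM
  have hcm : Measurable (cdf τ) := (monotone_cdf τ).measurable
  set w : ℝ × ℝ → ℝ := fun x => cdf τ x.2 with hw
  have hwm : Measurable w := hcm.comp measurable_snd
  have hw0 : ∀ x, 0 ≤ w x := fun x => cdf_nonneg τ _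
  have hwlt : ∀ u ∈ Icc (0 : ℝ) 1, ν.real {x | w x < u} = u := by
    intro u hu
    have h := measureReal_cdf_lt τ hu
    rw [hτ, map_measureReal_apply measurable_snd (measurableSet_lt hcm measurable_const)] at h
    exact h
  -- Since `F_T(T)` is uniform, these cells have mass `1 / M` each.
  set cell : ℝ × ℝ → ℕ := fun x => ⌊(M : ℝ) * w x⌋₊ with hcell
  set B : ℕ → Set (ℝ × ℝ) := fun c => {x | cell x = c} with hB
  have hcellm : Measurable cell := (hwm.const_mul _).nat_floor
  have hBm : ∀ c, MeasurableSet (B c) := fun c => hcellm (measurableSet_singleton c)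
  have hBν : ∀ c < M, ν.real (B c) = (M : ℝ)⁻¹ := by
    intro c hc
    have hc' : (c : ℝ) + 1 ≤ M := by exact_mod_cast hc
    have hBeq : B c = {x | w x < (c + 1) / M} \ {x | w x < c / M} := by
      ext x
      simp only [hB, hcell, mem_ofPred_eq, mem_sdiff, not_lt]
      rw [Nat.floor_eq_iff (mul_nonneg hM'.le (hw0 x)), lt_div_iff₀ hM', div_le_iff₀ hM',
        mul_comm (M : ℝ), and_comm]
    rw [hBeq, measureReal_sdiff (fun x hx => ?_) (measurableSet_lt hwm measurable_const),
      hwlt _ ⟨by positivity, (div_le_one hM').2 hc'⟩,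
      hwlt _ ⟨by positivity, (div_le_one hM').2 (by linarith)⟩]
    · field_simp
      ring
    · have hx' : w x < c / M := hx
      refine lt_trans hx' ?_
      gcongr
      linarith
  set IC : Finset (Fin n ⊕ Fin m) := Finset.univ.map ⟨Sum.inl, Sum.inl_injective⟩ with hIC
  set IU : Finset (Fin n ⊕ Fin m) := Finset.univ.map ⟨Sum.inr, Sum.inr_injective⟩ with hIU
  have hICc : IC.card = n := by simp [hIC]
  have hIUc : IU.card = m := by simp [hIU]
  set EC : ℕ → Set (Fin n ⊕ Fin m → ℝ × ℝ) := fun c =>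
    {z | 4 * (IC.card * ν.real (B c)) ≤ ((IC.filter fun i => z i ∈ B c).card : ℝ)} with hEC
  set EU : ℕ → Set (Fin n ⊕ Fin m → ℝ × ℝ) := fun c =>
    {z | ((IU.filter fun i => z i ∈ B c).card : ℝ) ≤ q} with hEU
  -- Excludes the value `F_T(T) = 1`, whose cell index would be `M`.
  have hlt1 : ∀ᵐ z ∂(sampleLaw n m ν), ∀ i, w (z i) < 1 := by
    rw [ae_all_iff]
    intro i
    have h1 : ∀ᵐ x ∂ν, w x < 1 := by
      have h2 : ν {x | w x < 1} = 1 := by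
        have := hwlt 1 (by simp)
        rw [measureReal_def, ENNReal.toReal_eq_one_iff] at this
        exact this
      exact (prob_compl_eq_zero_iff (measurableSet_lt hwm measurable_const)).2 h2
    exact (measurePreserving_eval (fun _ : Fin n ⊕ Fin m => ν) i).quasiMeasurePreserving.ae h1
  have hsub : ∀ᵐ z ∂(sampleLaw n m ν), z ∈ {z | ∀ (j : Fin m) (x : ℕ),
      poolWindow j (snds z) q x ≤ 2 * ⌊4 * ((n : ℝ) * (M : ℝ)⁻¹)⌋₊ + 1}ᶜ →
      z ∈ ⋃ c ∈ Finset.range M, (EC c ∪ EU c) := by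
    filter_upwards [hlt1] with z hz hbad
    by_contra hgood
    refine hbad fun j x => ?_
    simp only [mem_iUnion, mem_union, not_exists, not_or, Finset.mem_range] at hgood
    refine poolWindow_le_of_cells (cell := fun i => cell (z i)) (M := M) ?_ ?_ ?_ ?_ j x
    · intro i l hil
      exact Nat.floor_mono (mul_le_mul_of_nonneg_left (monotone_cdf τ hil) hM'.le)
    · intro i
      simp only [hcell]
      rw [Nat.floor_lt (mul_nonneg hM'.le (hw0 _))]
      nlinarith [hz i]
    · intro c hc
      have h := (hgood c hc).2
      simp only [hEU, mem_ofPred_eq, not_le] at h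
      rw [hIU, card_filter_inr] at h
      exact_mod_cast h
    · intro c hc
      have h := (hgood c hc).1
      simp only [hEC, mem_ofPred_eq, not_le] at h
      rw [hICc, hBν c hc, hIC, card_filter_inl] at h
      exact Nat.le_floor h.le
  have h1 : (sampleLaw n m ν).real {z | ∀ (j : Fin m) (x : ℕ),
      poolWindow j (snds z) q x ≤ 2 * ⌊4 * ((n : ℝ) * (M : ℝ)⁻¹)⌋₊ + 1}ᶜ ≤
      (sampleLaw n m ν).real (⋃ c ∈ Finset.range M, (EC c ∪ EU c)) :=
    ENNReal.toReal_mono (measure_ne_top _ _) (measure_mono_ae hsub)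
  refine h1.trans ((measureReal_biUnion_finset_le _ _).trans ?_)
  calc ∑ c ∈ Finset.range M, (sampleLaw n m ν).real (EC c ∪ EU c)
      ≤ ∑ _c ∈ Finset.range M,
        (Real.exp (-(2 * (n * (M : ℝ)⁻¹))) + Real.exp (q - m * (M : ℝ)⁻¹ / 2)) := by
        refine Finset.sum_le_sum fun c hc => (measureReal_union_le _ _).trans (add_le_add ?_ ?_)
        · have h := measureReal_card_ge_le (ν := ν) IC (hBm c)
          rw [hICc, hBν c (Finset.mem_range.1 hc)] at h
          simp only [hEC]
          rwa [hICc, hBν c (Finset.mem_range.1 hc)]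
        · have h := measureReal_card_le_le (ν := ν) IU (hBm c) q
          rw [hIUc, hBν c (Finset.mem_range.1 hc)] at h
          exact h
    _ = _ := by rw [Finset.sum_const, Finset.card_range, nsmul_eq_mul]

end

end SCOP

/-! ### The false coverage proportion through leave-one-out terms -/

namespace SCOP

noncomputable section

variable {n m : ℕ}

lemma mem_selectedTest_iff (κ : (Fin n ⊕ Fin m → ℝ) → ℕ) (T : Fin n ⊕ Fin m → ℝ) (j : Fin m) :
    j ∈ selectedTest κ T ↔ testRank T (Sum.inr j) < κ T := by
  simp only [selectedTest, Finset.mem_filter, Finset.mem_univ, true_and]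
  rw [← not_lt, testOrderStat, kthSmallest_lt_iff, not_le]
  rfl

lemma mem_selectedCal_iff (κ : (Fin n ⊕ Fin m → ℝ) → ℕ) (T : Fin n ⊕ Fin m → ℝ) (i : Fin n) :
    i ∈ selectedCal κ T ↔ testRank T (Sum.inl i) < κ T + 1 := by
  simp only [selectedCal, Finset.mem_filter, Finset.mem_univ, true_and]
  rw [← not_lt, testOrderStat, kthSmallest_lt_iff, not_le]
  rfl

/-- Indicator that the test point `j` exceeds the conformal quantile of the selected
calibration points. -/
def missed (α : ℝ) (κ : (Fin n ⊕ Fin m → ℝ) → ℕ) (R T : Fin n ⊕ Fin m → ℝ) (j : Fin m) : Prop :=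
  quantileRank α ((selectedCal κ T).card + 1) ≤
    ((selectedCal κ T).filter fun i => R (Sum.inl i) < R (Sum.inr j)).card

open Classical in
/-- The false coverage proportion as a function of residuals and scores. -/
def rankFCP (α : ℝ) (κ : (Fin n ⊕ Fin m → ℝ) → ℕ) (R T : Fin n ⊕ Fin m → ℝ) : ℝ :=
  (((selectedTest κ T).filter fun j => missed α κ R T j).card : ℝ) /
    (max (selectedTest κ T).card 1 : ℕ)

lemma falseCoverageProportion_eq {E : Type*} (α : ℝ) (κ : (Fin n ⊕ Fin m → ℝ) → ℕ)
    (g f : E → ℝ) (x : Fin n ⊕ Fin m → E) (y : Fin n ⊕ Fin m → ℝ) :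
    falseCoverageProportion α κ g f x y = rankFCP α κ (residual f x y) (score g x) := by
  classical
  unfold falseCoverageProportion rankFCP
  have h : ∀ j, (y (Sum.inr j) ∉ predInterval α κ g f x y j ↔
      missed α κ (residual f x y) (score g x) j) := by
    intro j
    simp only [predInterval, mem_ofPred_eq, not_le, conformalQuantile]
    rw [kthSmallest_lt_iff]
    unfold missed quantileRank
    push_cast
    rfl
  simp only [h]

lemma card_selectedTest {κ : (Fin n ⊕ Fin m → ℝ) → ℕ} {T : Fin n ⊕ Fin m → ℝ}
    (hT : Function.Injective T) (hκ : κ T ≤ m) : (selectedTest κ T).card = κ T := by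
  have : selectedTest κ T = Finset.univ.filter fun l : Fin m => testRank T (Sum.inr l) < κ T := by
    ext j; simp [mem_selectedTest_iff]
  rw [this, card_testRank_lt hT hκ]

/-- Here the inflation to `κ + 1` is used: for a calibration score above `T_j`, omitting `j` lowers
its rank by exactly one, so the condition `< κ + 1` becomes `< κ`. A score not above `T_j` has rank
at most that of `j`, and satisfies both. -/
lemma poolSel_eq_of_selected {κ : (Fin n ⊕ Fin m → ℝ) → ℕ} {T : Fin n ⊕ Fin m → ℝ} {j : Fin m}
    (hj : testRank T (Sum.inr j) < κ T) :
    poolSel j T (κ T) =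
      insert (Sum.inr j) ((selectedCal κ T).map ⟨Sum.inl, Sum.inl_injective⟩) := by
  ext i
  simp only [poolSel, pool, Finset.mem_filter, Finset.mem_insert, Finset.mem_map, Finset.mem_univ,
    true_and, Function.Embedding.coeFn_mk]
  constructor
  · rintro ⟨rfl | ⟨k, rfl⟩, h⟩
    · exact Or.inl rfl
    · refine Or.inr ⟨k, ?_, rfl⟩
      rw [mem_selectedCal_iff]
      have h3 := testRank_eq_looRank_add j T (Sum.inl k)
      have h4 : (if T (Sum.inr j) < T (Sum.inl k) then 1 else 0) ≤ 1 := by split_ifs <;> simp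
      omega
  · rintro (rfl | ⟨k, hk, rfl⟩)
    · exact ⟨Or.inl rfl, by rwa [looRank_self]⟩
    · refine ⟨Or.inr ⟨k, rfl⟩, ?_⟩
      rw [mem_selectedCal_iff] at hk
      have h3 := testRank_eq_looRank_add j T (Sum.inl k)
      split_ifs at h3 with h
      · omega
      · have := testRank_mono (not_lt.1 h)
        omega

-- The pool selection has one point more than the selected calibration set, so its quantile rank is
-- the conformal rank `⌈(1 - α)(|S| + 1)⌉` for that set `S`; and `j` does not count towards its own
-- residual rank.
open Classical in
lemma exceeds_eq_missed (α : ℝ) {κ : (Fin n ⊕ Fin m → ℝ) → ℕ} (R : Fin n ⊕ Fin m → ℝ)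
    {T : Fin n ⊕ Fin m → ℝ} {j : Fin m} (hj : testRank T (Sum.inr j) < κ T) :
    exceeds α R (poolSel j T (κ T)) (Sum.inr j) = if missed α κ R T j then 1 else 0 := by
  have h1 : (poolSel j T (κ T)).card = (selectedCal κ T).card + 1 := by
    rw [poolSel_eq_of_selected hj, Finset.card_insert_of_notMem (by simp), Finset.card_map]
  have h2 : rankIn (poolSel j T (κ T)) R (Sum.inr j) =
      ((selectedCal κ T).filter fun i => R (Sum.inl i) < R (Sum.inr j)).card := by
    rw [rankIn, poolSel_eq_of_selected hj, Finset.filter_insert, if_neg (lt_irrefl _),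
      Finset.filter_map, Finset.card_map]
    rfl
  unfold exceeds
  rw [h1, h2]
  exact if_congr Iff.rfl rfl rfl

/-- The false coverage proportion is a sum of leave-one-out terms up to the unstable ones. -/
lemma abs_rankFCP_sub_le {α : ℝ} (hα : α ∈ Ioo (0 : ℝ) 1) {κ : (Fin n ⊕ Fin m → ℝ) → ℕ} {tu : ℝ}
    {Iu k₀ : ℕ} (hk₀ : 0 < k₀) (R : Fin n ⊕ Fin m → ℝ) {T : Fin n ⊕ Fin m → ℝ}
    (hT : Function.Injective T) (hκ₀ : k₀ ≤ κ T) (hκ : κ T ≤ m)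
    (hsel : ∀ j : Fin m, testRank T (Sum.inr j) < κ T → looLevel κ tu j T = κ T)
    (hunsel : ∀ j : Fin m, κ T ≤ testRank T (Sum.inr j) →
      κ T ≤ looLevel κ tu j T ∧ looLevel κ tu j T ≤ κ T + Iu) :
    |rankFCP α κ R T - α - ∑ j, looTerm α j R T (looLevel κ tu j T)| ≤ Iu * (k₀ : ℝ)⁻¹ := by
  classical
  have hκpos : 0 < κ T := hk₀.trans_le hκ₀
  have hκ' : (0 : ℝ) < κ T := by exact_mod_cast hκpos
  have h1 : rankFCP α κ R T - α = ∑ j : Fin m, if testRank T (Sum.inr j) < κ T then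
      ((if missed α κ R T j then 1 else 0) - α) / κ T else 0 := by
    rw [← Finset.sum_filter, ← Finset.sum_div, Finset.sum_sub_distrib, Finset.sum_boole,
      Finset.sum_const, card_testRank_lt hT hκ, rankFCP, card_selectedTest hT hκ,
      max_eq_left (by omega), nsmul_eq_mul]
    have : selectedTest κ T = Finset.univ.filter fun l : Fin m => testRank T (Sum.inr l) < κ T := by
      ext j; simp [mem_selectedTest_iff]
    rw [this]
    field_simp
  -- Selected points contribute no error. An unselected one contributes only if its rank is below
  -- its own level, hence in `[κ, κ + Iu)`.
  have h2 : ∀ j : Fin m, |(if testRank T (Sum.inr j) < κ T then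
      ((if missed α κ R T j then 1 else 0) - α) / κ T else 0) -
      looTerm α j R T (looLevel κ tu j T)| ≤
      if κ T ≤ testRank T (Sum.inr j) ∧ testRank T (Sum.inr j) < κ T + Iu then (k₀ : ℝ)⁻¹
        else 0 := by
    intro j
    by_cases hj : testRank T (Sum.inr j) < κ T
    · have hmem : Sum.inr j ∈ poolSel j T (κ T) := by
        simpa [poolSel, inr_mem_pool, looRank_self] using hj
      rw [if_pos hj, hsel j hj, looTerm, if_pos hmem, exceeds_eq_missed α R hj, sub_self, abs_zero]
      split_ifs <;> positivity
    · have hj' := not_lt.1 hj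
      have hu := hunsel j hj'
      rw [if_neg hj, zero_sub, abs_neg]
      by_cases hin : testRank T (Sum.inr j) < looLevel κ tu j T
      · rw [if_pos ⟨hj', by omega⟩]
        refine (abs_looTerm_le hα j R T _).trans ?_
        have : (k₀ : ℝ) ≤ looLevel κ tu j T := by exact_mod_cast hκ₀.trans hu.1
        have hk' : (0 : ℝ) < k₀ := by exact_mod_cast hk₀
        gcongr
      · rw [looTerm, if_neg, abs_zero]
        · split_ifs <;> positivity
        · simpa [poolSel, inr_mem_pool, looRank_self] using hin
  rw [h1, ← Finset.sum_sub_distrib]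
  refine (Finset.abs_sum_le_sum_abs _ _).trans ((Finset.sum_le_sum fun j _ => h2 j).trans ?_)
  rw [← Finset.sum_filter, Finset.sum_const, nsmul_eq_mul]
  refine mul_le_mul_of_nonneg_right ?_ (by positivity)
  have := card_testRank_window hT (κ T) (κ T + Iu)
  rw [Nat.add_sub_cancel_left] at this
  exact_mod_cast this

/-- A bound free of both `j` and the level, so that after summing over `j` a single inverse moment
has to be estimated. The `+ 1` is the point `j`, which lies in its own selection. -/
lemma selfWeight_le_calBelow {k₀ a : ℕ} (hk₀ : 0 < k₀) (ha : k₀ ≤ a) (j : Fin m)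
    (T : Fin n ⊕ Fin m → ℝ) :
    selfWeight j T a ≤ (k₀ : ℝ)⁻¹ * ((calBelow k₀ T : ℝ) + 1)⁻¹ := by
  unfold selfWeight
  split_ifs with h
  · rw [mul_inv]
    have hk' : (0 : ℝ) < k₀ := by exact_mod_cast hk₀
    have h1 : (calBelow k₀ T : ℝ) + 1 ≤ (poolSel j T a).card := by
      have : calBelow k₀ T + 1 ≤ (poolSel j T a).card := by
        have hsub : insert (Sum.inr j) ((Finset.univ.filter fun k : Fin n =>
            testRank T (Sum.inl k) < k₀).map ⟨Sum.inl, Sum.inl_injective⟩) ⊆ poolSel j T a := by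
          intro i hi
          simp only [Finset.mem_insert, Finset.mem_map, Finset.mem_filter, Finset.mem_univ,
            true_and, Function.Embedding.coeFn_mk] at hi
          rcases hi with rfl | ⟨k, hk, rfl⟩
          · exact h
          · have := looRank_le_testRank j T (Sum.inl k)
            simp only [poolSel, Finset.mem_filter, inl_mem_pool, true_and]
            omega
        have := Finset.card_le_card hsub
        rwa [Finset.card_insert_of_notMem (by simp), Finset.card_map] at this
      exact_mod_cast this
    have h2 : (k₀ : ℝ) ≤ a := by exact_mod_cast ha
    gcongr
  · positivity

/-- The total leave-one-out cost when rank windows contain at most `D` points. -/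
lemma sum_looCost_le {α : ℝ} (hα : α ∈ Ioo (0 : ℝ) 1) {κ : (Fin n ⊕ Fin m → ℝ) → ℕ} {tu : ℝ}
    {Iu Ic k₀ D : ℕ} (hk₀ : 0 < k₀) {R : Fin n ⊕ Fin m → ℝ} {T : Fin n ⊕ Fin m → ℝ}
    (hR : Function.Injective R) (hT : Function.Injective T) (hκ₀ : k₀ ≤ κ T)
    (hlev : ∀ j : Fin m, κ T ≤ looLevel κ tu j T ∧ looLevel κ tu j T ≤ κ T + Iu)
    (hpair : ∀ (j : Fin m) (k : Fin n),
      looLevel κ tu j T ≤ looLevel κ tu j (T ∘ exch k j) + Ic ∧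
      looLevel κ tu j (T ∘ exch k j) ≤ looLevel κ tu j T + Ic)
    (hD : ∀ (j : Fin m) (x : ℕ), poolWindow j T Ic x ≤ D) :
    ∑ j, looCost α j R T (looLevel κ tu j T) (fun k => looLevel κ tu j (T ∘ exch k j)) ≤
      m * (k₀ : ℝ)⁻¹ * ((1 + 6 * D) * ((calBelow k₀ T : ℝ) + 1)⁻¹ + 2 * Ic * (k₀ : ℝ)⁻¹) +
        2 * (Ic + Iu) * (k₀ : ℝ)⁻¹ := by
  have hk' : (0 : ℝ) < k₀ := by exact_mod_cast hk₀
  have h1 : ∀ j, looCost α j R T (looLevel κ tu j T)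
      (fun k => looLevel κ tu j (T ∘ exch k j)) ≤
      (k₀ : ℝ)⁻¹ * ((1 + 6 * D) * ((calBelow k₀ T : ℝ) + 1)⁻¹ + 2 * Ic * (k₀ : ℝ)⁻¹) +
      2 * (if κ T - Ic ≤ testRank T (Sum.inr j) ∧ testRank T (Sum.inr j) < κ T + Iu then
        (k₀ : ℝ)⁻¹ else 0) := by
    intro j
    have hka : k₀ ≤ looLevel κ tu j T := hκ₀.trans (hlev j).1
    have hka' : (k₀ : ℝ) ≤ looLevel κ tu j T := by exact_mod_cast hka
    refine (looCost_le hα j hR T (q := Ic) (D := D) (hk₀.trans_le hka) (fun k => (hpair j k).1)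
      (fun k => (hpair j k).2) (hD j)).trans ?_
    have e1 := mul_le_mul_of_nonneg_left (selfWeight_le_calBelow hk₀ hka j T)
      (by positivity : (0 : ℝ) ≤ 1 + 6 * D)
    have e0 : ((looLevel κ tu j T : ℝ))⁻¹ ≤ (k₀ : ℝ)⁻¹ := by gcongr
    have e2 : 2 * (Ic : ℝ) * (looLevel κ tu j T : ℝ)⁻¹ * (looLevel κ tu j T : ℝ)⁻¹ ≤
        2 * Ic * (k₀ : ℝ)⁻¹ * (k₀ : ℝ)⁻¹ := by gcongr
    -- The levels vary with `j`, but all lie in `[κ, κ + Iu]`. The enlarged window makes the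
    -- condition on the rank of `j` common to all `j`, so at most `Ic + Iu` of them satisfy it.
    have e3 : (if looLevel κ tu j T ≤ testRank T (Sum.inr j) + Ic ∧
        testRank T (Sum.inr j) < looLevel κ tu j T then (looLevel κ tu j T : ℝ)⁻¹ else 0) ≤
        if κ T - Ic ≤ testRank T (Sum.inr j) ∧ testRank T (Sum.inr j) < κ T + Iu then
        (k₀ : ℝ)⁻¹ else 0 := by
      have := hlev j
      split_ifs with ha hb
      · exact e0
      · exact absurd ⟨by omega, by omega⟩ hb
      · positivity
      · exact le_rfl
    linarith
  refine (Finset.sum_le_sum fun j _ => h1 j).trans ?_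
  rw [Finset.sum_add_distrib, Finset.sum_const, ← Finset.mul_sum, ← Finset.sum_filter,
    Finset.sum_const, nsmul_eq_mul, nsmul_eq_mul, Finset.card_univ, Fintype.card_fin]
  have h2 : ((Finset.univ.filter fun j : Fin m => κ T - Ic ≤ testRank T (Sum.inr j) ∧
      testRank T (Sum.inr j) < κ T + Iu).card : ℝ) ≤ Ic + Iu := by
    have := card_testRank_window hT (κ T - Ic) (κ T + Iu)
    have h3 : (Finset.univ.filter fun j : Fin m => κ T - Ic ≤ testRank T (Sum.inr j) ∧
      testRank T (Sum.inr j) < κ T + Iu).card ≤ Ic + Iu := this.trans (by omega)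
    exact_mod_cast h3
  have h4 := mul_le_mul_of_nonneg_right h2 (inv_nonneg.2 hk'.le)
  nlinarith

end

end SCOP

/-! ### The integrated bound and the choice of the window size -/

namespace SCOP

noncomputable section

variable {n m : ℕ}

lemma rankFCP_mem_Icc (α : ℝ) (κ : (Fin n ⊕ Fin m → ℝ) → ℕ) (R T : Fin n ⊕ Fin m → ℝ) :
    rankFCP α κ R T ∈ Icc (0 : ℝ) 1 := by
  classical
  unfold rankFCP
  refine ⟨by positivity, div_le_one_of_le₀ ?_ (by positivity)⟩
  exact_mod_cast (Finset.card_filter_le _ _).trans (le_max_left _ _)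

lemma measurable_rankFCP (α : ℝ) {κ : (Fin n ⊕ Fin m → ℝ) → ℕ} (hκ : Measurable κ)
    {Z : Type*} [MeasurableSpace Z] {R T : Z → Fin n ⊕ Fin m → ℝ} (hR : Measurable R)
    (hT : Measurable T) : Measurable fun z => rankFCP α κ (R z) (T z) := by
  classical
  have hcast : Measurable fun x : ℕ => (x : ℝ) := Measurable.of_discrete
  have hκT : Measurable fun z => κ (T z) := hκ.comp hT
  have h1 : ∀ j, MeasurableSet {z | testRank (T z) (Sum.inr j) < κ (T z)} := fun j =>
    measurableSet_lt (measurable_testRank hT _) hκT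
  have h2 : ∀ i, MeasurableSet {z | testRank (T z) (Sum.inl i) < κ (T z) + 1} := fun i =>
    measurableSet_lt (measurable_testRank hT _) (hκT.add_const 1)
  have hst : ∀ z, selectedTest κ (T z) =
      Finset.univ.filter fun j : Fin m => testRank (T z) (Sum.inr j) < κ (T z) := by
    intro z; ext j; simp [mem_selectedTest_iff]
  have hsc : ∀ z, selectedCal κ (T z) =
      Finset.univ.filter fun i : Fin n => testRank (T z) (Sum.inl i) < κ (T z) + 1 := by
    intro z; ext j; simp [mem_selectedCal_iff]
  have hmiss : ∀ j, MeasurableSet {z | missed α κ (R z) (T z) j} := by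
    intro j
    simp only [missed, hsc, Finset.filter_filter]
    refine measurableSet_le ((Measurable.of_discrete (f := fun x => quantileRank α (x + 1))).comp
      (measurable_card_filter _ h2)) (measurable_card_filter _ fun i => (h2 i).inter ?_)
    exact measurableSet_coord_lt hR _ _
  have hnum : Measurable fun z => (Finset.univ.filter fun j : Fin m =>
      testRank (T z) (Sum.inr j) < κ (T z) ∧ missed α κ (R z) (T z) j).card :=
    measurable_card_filter _ fun j => (h1 j).inter (hmiss j)
  have hden : Measurable fun z => max (Finset.univ.filter fun j : Fin m =>
      testRank (T z) (Sum.inr j) < κ (T z)).card 1 :=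
    (measurable_card_filter _ h1).max measurable_const
  have heq : (fun z => rankFCP α κ (R z) (T z)) = fun z =>
      ((Finset.univ.filter fun j : Fin m =>
        testRank (T z) (Sum.inr j) < κ (T z) ∧ missed α κ (R z) (T z) j).card : ℝ) /
      (max (Finset.univ.filter fun j : Fin m => testRank (T z) (Sum.inr j) < κ (T z)).card 1 : ℕ) := by
    funext z
    rw [rankFCP, hst, Finset.filter_filter]
  rw [heq]
  exact (hcast.comp hnum).div (hcast.comp hden)

variable {ν : Measure (ℝ × ℝ)} [IsProbabilityMeasure ν]

/-- The mean false coverage proportion under stability, in terms of the probability that a rank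
window contains more than `D` points. -/
theorem abs_integral_rankFCP_sub_le {α : ℝ} (hα : α ∈ Ioo (0 : ℝ) 1)
    {κ : (Fin n ⊕ Fin m → ℝ) → ℕ} (hκ : Measurable κ) {tu : ℝ} {Iu Ic k₀ D : ℕ} (hk₀ : 0 < k₀)
    (hinjR : ∀ᵐ z ∂(sampleLaw n m ν), Function.Injective (fsts z))
    (hinjT : ∀ᵐ z ∂(sampleLaw n m ν), Function.Injective (snds z))
    (hrange : ∀ᵐ z ∂(sampleLaw n m ν), k₀ ≤ κ (snds z) ∧ κ (snds z) ≤ m)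
    (hsel : ∀ᵐ z ∂(sampleLaw n m ν), ∀ j : Fin m, testRank (snds z) (Sum.inr j) < κ (snds z) →
      looLevel κ tu j (snds z) = κ (snds z))
    (hunsel : ∀ᵐ z ∂(sampleLaw n m ν), ∀ j : Fin m, κ (snds z) ≤ testRank (snds z) (Sum.inr j) →
      κ (snds z) ≤ looLevel κ tu j (snds z) ∧ looLevel κ tu j (snds z) ≤ κ (snds z) + Iu)
    (hpair : ∀ᵐ z ∂(sampleLaw n m ν), ∀ (j : Fin m) (k : Fin n),
      looLevel κ tu j (snds z) ≤ looLevel κ tu j (snds z ∘ exch k j) + Ic ∧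
      looLevel κ tu j (snds z ∘ exch k j) ≤ looLevel κ tu j (snds z) + Ic) :
    |∫ z, rankFCP α κ (fsts z) (snds z) ∂(sampleLaw n m ν) - α| ≤
      Iu * (k₀ : ℝ)⁻¹ + (m * (k₀ : ℝ)⁻¹ *
        ((1 + 6 * D) * ∫ z, ((calBelow k₀ (snds z) : ℝ) + 1)⁻¹ ∂(sampleLaw n m ν) +
          2 * Ic * (k₀ : ℝ)⁻¹ +
          4 * (sampleLaw n m ν).real {z | ∀ (j : Fin m) (x : ℕ),
            poolWindow j (snds z) Ic x ≤ D}ᶜ) + 2 * (Ic + Iu) * (k₀ : ℝ)⁻¹) := by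
  classical
  set π := sampleLaw n m ν with hπ
  have hR := measurable_fsts (n := n) (m := m)
  have hT := measurable_snds (n := n) (m := m)
  have hk' : (0 : ℝ) < k₀ := by exact_mod_cast hk₀
  have ha : ∀ j, Measurable fun z : Fin n ⊕ Fin m → ℝ × ℝ => looLevel κ tu j (snds z) :=
    fun j => (measurable_looLevel hκ tu j).comp hT
  have hb : ∀ (j : Fin m) (k : Fin n), Measurable fun z : Fin n ⊕ Fin m → ℝ × ℝ =>
      looLevel κ tu j (snds z ∘ exch k j) := fun j k =>
    (measurable_looLevel hκ tu j).comp (by unfold snds; fun_prop)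
  have hlev : ∀ᵐ z ∂π, ∀ j : Fin m, κ (snds z) ≤ looLevel κ tu j (snds z) ∧
      looLevel κ tu j (snds z) ≤ κ (snds z) + Iu := by
    filter_upwards [hsel, hunsel] with z h1 h2 j
    rcases lt_or_ge (testRank (snds z) (Sum.inr j)) (κ (snds z)) with h | h
    · rw [h1 j h]; omega
    · exact h2 j h
  have hfcp : Integrable (fun z => rankFCP α κ (fsts z) (snds z)) π :=
    integrable_of_measurable_of_le (measurable_rankFCP α hκ hR hT) 1 fun z => by
      have := rankFCP_mem_Icc α κ (fsts z) (snds z)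
      rw [abs_of_nonneg this.1]; exact this.2
  have hterm : ∀ j, Integrable (fun z => looTerm α j (fsts z) (snds z)
      (looLevel κ tu j (snds z))) π := fun j =>
    integrable_of_measurable_of_le (measurable_looTerm α hR hT (ha j) j) 1 fun z =>
      (abs_looTerm_le hα _ _ _ _).trans (Nat.cast_inv_le_one _)
  have hcost : ∀ j, Integrable (fun z => looCost α j (fsts z) (snds z)
      (looLevel κ tu j (snds z)) (fun k => looLevel κ tu j (snds z ∘ exch k j))) π := fun j =>
    integrable_of_measurable_of_le (measurable_looCost α hR hT (ha j) (hb j) j) 4 fun z => by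
      rw [abs_of_nonneg (looCost_nonneg _ _ _ _ _ _)]
      refine (looCost_le_trivial _ _ _ _ _ _).trans ?_
      linarith [Nat.cast_inv_le_one (α := ℝ) (looLevel κ tu j (snds z))]
  have hsplit : |∫ z, rankFCP α κ (fsts z) (snds z) ∂π - α -
      ∑ j, ∫ z, looTerm α j (fsts z) (snds z) (looLevel κ tu j (snds z)) ∂π| ≤
      Iu * (k₀ : ℝ)⁻¹ := by
    have e1 : ∫ z, rankFCP α κ (fsts z) (snds z) ∂π - α -
        ∑ j, ∫ z, looTerm α j (fsts z) (snds z) (looLevel κ tu j (snds z)) ∂π =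
        ∫ z, (rankFCP α κ (fsts z) (snds z) - α -
          ∑ j, looTerm α j (fsts z) (snds z) (looLevel κ tu j (snds z))) ∂π := by
      rw [← integral_finsetSum _ fun j _ => hterm j]
      have e2 : ∫ z, rankFCP α κ (fsts z) (snds z) ∂π - α =
          ∫ z, (rankFCP α κ (fsts z) (snds z) - α) ∂π := by
        rw [integral_sub hfcp (integrable_const _)]
        simp
      rw [e2]
      exact (integral_sub (hfcp.sub (integrable_const _))
        (integrable_finsetSum _ fun j _ => hterm j)).symm
    rw [e1]
    have h := norm_integral_le_of_norm_le_const (μ := π) (C := Iu * (k₀ : ℝ)⁻¹)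
      (f := fun z => rankFCP α κ (fsts z) (snds z) - α -
          ∑ j, looTerm α j (fsts z) (snds z) (looLevel κ tu j (snds z))) (by
        filter_upwards [hinjT, hrange, hsel, hunsel] with z h1 h2 h3 h4
        exact abs_rankFCP_sub_le hα hk₀ (fsts z) h1 h2.1 h2.2 h3 h4)
    simpa using h
  set G : Set (Fin n ⊕ Fin m → ℝ × ℝ) :=
    {z | ∀ (j : Fin m) (x : ℕ), poolWindow j (snds z) Ic x ≤ D} with hG
  have hGm : MeasurableSet G := measurableSet_poolWindow_le hT Ic D
  have hN : Integrable (fun z => ((calBelow k₀ (snds z) : ℝ) + 1)⁻¹) π := by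
    refine integrable_of_measurable_of_le ((((Measurable.of_discrete
      (f := fun x : ℕ => (x : ℝ))).comp (measurable_calBelow hT k₀)).add_const 1).inv) 1
      fun z => ?_
    have h0 : (0 : ℝ) ≤ calBelow k₀ (snds z) := Nat.cast_nonneg _
    rw [abs_of_nonneg (by positivity)]
    exact inv_le_one_of_one_le₀ (by linarith)
  have hind : Integrable (Gᶜ.indicator fun _ => (1 : ℝ)) π :=
    (integrable_const _).indicator hGm.compl
  have hcosts : ∑ j, ∫ z, looCost α j (fsts z) (snds z) (looLevel κ tu j (snds z))
      (fun k => looLevel κ tu j (snds z ∘ exch k j)) ∂π ≤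
      m * (k₀ : ℝ)⁻¹ * ((1 + 6 * D) * ∫ z, ((calBelow k₀ (snds z) : ℝ) + 1)⁻¹ ∂π +
          2 * Ic * (k₀ : ℝ)⁻¹ + 4 * π.real Gᶜ) + 2 * (Ic + Iu) * (k₀ : ℝ)⁻¹ := by
    rw [← integral_finsetSum _ fun j _ => hcost j]
    have e1 : m * (k₀ : ℝ)⁻¹ * ((1 + 6 * D) * ∫ z, ((calBelow k₀ (snds z) : ℝ) + 1)⁻¹ ∂π +
          2 * Ic * (k₀ : ℝ)⁻¹ + 4 * π.real Gᶜ) + 2 * (Ic + Iu) * (k₀ : ℝ)⁻¹ =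
        ∫ z, ((m * (k₀ : ℝ)⁻¹ * (1 + 6 * D)) * ((calBelow k₀ (snds z) : ℝ) + 1)⁻¹ +
          (m * (k₀ : ℝ)⁻¹ * 4) * Gᶜ.indicator (fun _ => (1 : ℝ)) z +
          (m * (k₀ : ℝ)⁻¹ * (2 * Ic * (k₀ : ℝ)⁻¹) + 2 * (Ic + Iu) * (k₀ : ℝ)⁻¹)) ∂π := by
      have i1 := hN.const_mul (m * (k₀ : ℝ)⁻¹ * (1 + 6 * D))
      have i2 := hind.const_mul (m * (k₀ : ℝ)⁻¹ * 4)
      have e2 := integral_add (i1.add i2) (integrable_const (μ := π)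
        (m * (k₀ : ℝ)⁻¹ * (2 * Ic * (k₀ : ℝ)⁻¹) + 2 * (Ic + Iu) * (k₀ : ℝ)⁻¹))
      have e3 := integral_add i1 i2
      simp only [Pi.add_apply] at e2
      rw [e2, e3, integral_const_mul, integral_const_mul, integral_indicator_const _ hGm.compl]
      simp only [integral_const, probReal_univ, smul_eq_mul, mul_one, one_mul]
      ring
    rw [e1]
    refine integral_mono_ae (integrable_finsetSum _ fun j _ => hcost j)
      (((hN.const_mul _).add (hind.const_mul _)).add (integrable_const _)) ?_
    filter_upwards [hinjR, hinjT, hrange, hlev, hpair] with z h1 h2 h3 h4 h5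
    -- The sharp cost holds on the event `G` that windows are sparse; off `G` each `j` costs at most
    -- `4 / k₀`.
    by_cases hz : z ∈ G
    · have h := sum_looCost_le hα hk₀ h1 h2 h3.1 h4 h5 hz
      have hz' : z ∉ Gᶜ := fun h => h hz
      simp only [indicator_of_notMem hz']
      linarith
    · have hz' : z ∈ Gᶜ := hz
      simp only [indicator_of_mem hz']
      have h : ∀ j, looCost α j (fsts z) (snds z) (looLevel κ tu j (snds z))
          (fun k => looLevel κ tu j (snds z ∘ exch k j)) ≤ 4 * (k₀ : ℝ)⁻¹ := by
        intro j
        refine (looCost_le_trivial _ _ _ _ _ _).trans ?_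
        have : (k₀ : ℝ) ≤ looLevel κ tu j (snds z) := by exact_mod_cast h3.1.trans (h4 j).1
        gcongr
      have h' := Finset.sum_le_sum fun j (_ : j ∈ Finset.univ) => h j
      rw [Finset.sum_const, Finset.card_univ, Fintype.card_fin, nsmul_eq_mul] at h'
      refine h'.trans ?_
      have p1 : 0 ≤ m * (k₀ : ℝ)⁻¹ * (1 + 6 * D) * ((calBelow k₀ (snds z) : ℝ) + 1)⁻¹ := by
        positivity
      have p2 : 0 ≤ m * (k₀ : ℝ)⁻¹ * (2 * Ic * (k₀ : ℝ)⁻¹) + 2 * (Ic + Iu) * (k₀ : ℝ)⁻¹ := by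
        positivity
      linarith
  have hterms : |∑ j, ∫ z, looTerm α j (fsts z) (snds z) (looLevel κ tu j (snds z)) ∂π| ≤
      ∑ j, ∫ z, looCost α j (fsts z) (snds z) (looLevel κ tu j (snds z))
      (fun k => looLevel κ tu j (snds z ∘ exch k j)) ∂π :=
    (Finset.abs_sum_le_sum_abs _ _).trans
      (Finset.sum_le_sum fun j _ => abs_integral_looTerm_le hα hκ tu j hinjR)
  have := abs_add_le (∫ z, rankFCP α κ (fsts z) (snds z) ∂π - α -
      ∑ j, ∫ z, looTerm α j (fsts z) (snds z) (looLevel κ tu j (snds z)) ∂π)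
      (∑ j, ∫ z, looTerm α j (fsts z) (snds z) (looLevel κ tu j (snds z)) ∂π)
  rw [sub_add_cancel] at this
  linarith

lemma half_le_log {x : ℝ} (hx : 2 ≤ x) : 1 / 2 ≤ Real.log x := by
  have := Real.log_two_gt_d9
  have := Real.log_le_log (by norm_num) hx
  linarith

/-- A choice of window bound `D` for which the exceptional probability and `D / n` are of order
`Ic log m / m + log n / n`. -/
lemma exists_poolWindow_bound (hν : ∀ c, ν {x | x.2 = c} = 0) (hn : 2 ≤ n) (hm : 2 ≤ m) {Ic : ℕ}
    (hh : 20 * (Ic * Real.log m / m + Real.log n / n) < 1) :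
    ∃ D : ℕ, (1 + 6 * (D : ℝ)) / n ≤ 2200 * (Ic * Real.log m / m + Real.log n / n) ∧
      (sampleLaw n m ν).real {z | ∀ (j : Fin m) (x : ℕ),
        poolWindow j (snds z) Ic x ≤ D}ᶜ ≤ 4 * (Ic * Real.log m / m + Real.log n / n) := by
  have hn' : (2 : ℝ) ≤ n := by exact_mod_cast hn
  have hm' : (2 : ℝ) ≤ m := by exact_mod_cast hm
  have hn0 : (0 : ℝ) < n := by linarith
  have hm0 : (0 : ℝ) < m := by linarith
  have hln := half_le_log hn'
  have hlm := half_le_log hm'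
  set A : ℝ := Ic * Real.log m / m with hA
  set B : ℝ := Real.log n / n with hB
  have hA0 : 0 ≤ A := by positivity
  have hnB : n * B = Real.log n := by rw [hB]; field_simp
  have hmA : m * A = Ic * Real.log m := by rw [hA]; field_simp
  have hB0 : 0 < B := by rw [hB]; positivity
  -- For `Ic = 0` all windows are empty and `D = 0` works without any cells.
  rcases Nat.eq_zero_or_pos Ic with h0 | hpos
  · refine ⟨0, ?_, ?_⟩
    · rw [div_le_iff₀ hn0]
      push_cast
      have hnA : 0 ≤ n * A := by positivity
      linarith
    · have : {z : Fin n ⊕ Fin m → ℝ × ℝ | ∀ (j : Fin m) (x : ℕ),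
          poolWindow j (snds z) Ic x ≤ 0}ᶜ = ∅ := by
        rw [compl_empty_iff, eq_univ_iff_forall]
        intro z j x
        rw [h0, poolWindow, Nat.le_zero, Finset.card_eq_zero, Finset.filter_eq_empty_iff]
        intro i _ hi
        omega
      rw [this, measureReal_empty]
      positivity
  -- The cell mass `1 / M` lies between `h` and `2h`. The part `B` of `h` gives every cell about
  -- `log n` calibration points or more in mean, and `20 A` gives `20 Ic log m` test points or more.
  · set h : ℝ := 20 * A + B with hh_def
    have hh0 : 0 < h := by positivity
    have hh1 : h < 1 := by linarith
    set M : ℕ := ⌊h⁻¹⌋₊ with hM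
    have hinv : 1 < h⁻¹ := (one_lt_inv₀ hh0).2 hh1
    have hM1 : 1 ≤ M := Nat.le_floor (by exact_mod_cast hinv.le)
    have hMle : (M : ℝ) ≤ h⁻¹ := Nat.floor_le (by positivity)
    have hMlt : h⁻¹ < M + 1 := Nat.lt_floor_add_one _
    have hM1' : (1 : ℝ) ≤ M := by exact_mod_cast hM1
    have hM0 : (0 : ℝ) < M := by linarith
    have hlow : h ≤ (M : ℝ)⁻¹ := by
      rw [le_inv_comm₀ hh0 hM0]; exact hMle
    have hupp : (M : ℝ)⁻¹ ≤ 2 * h := by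
      rw [inv_le_iff_one_le_mul₀ hM0]
      have : h⁻¹ * h = 1 := inv_mul_cancel₀ hh0.ne'
      nlinarith
    have hnh : Real.log n ≤ n * h := by
      rw [← hnB]
      exact mul_le_mul_of_nonneg_left (by linarith) hn0.le
    have hmh : 20 * (Ic * Real.log m) ≤ m * h := by
      rw [← hmA, mul_left_comm]
      exact mul_le_mul_of_nonneg_left (by linarith) hm0.le
    have hMh : M * h ≤ 1 := by
      have := mul_le_mul_of_nonneg_right hMle hh0.le
      rwa [inv_mul_cancel₀ hh0.ne'] at this
    have hIc1 : (1 : ℝ) ≤ Ic := by exact_mod_cast hpos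
    have hIcl : (Ic : ℝ) ≤ 2 * (Ic * Real.log m) := by
      have := mul_le_mul_of_nonneg_left hlm (by linarith : (0 : ℝ) ≤ Ic)
      linarith
    have hIcl' : Real.log m ≤ Ic * Real.log m := le_mul_of_one_le_left (by linarith) hIc1
    refine ⟨2 * ⌊4 * ((n : ℝ) * (M : ℝ)⁻¹)⌋₊ + 1, ?_, ?_⟩
    -- Here `1 + 6D ≤ 7 + 48 n / M ≤ 7 + 96 n h`, where `96 n h = 1920 n A + 96 n B`, and `7 ≤ 14 n
    -- B` as `log n ≥ 1/2`.
    · rw [div_le_iff₀ hn0]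
      have hfl := Nat.floor_le (by positivity : 0 ≤ 4 * ((n : ℝ) * (M : ℝ)⁻¹))
      have h2 : (n : ℝ) * (M : ℝ)⁻¹ ≤ n * (2 * h) := mul_le_mul_of_nonneg_left hupp hn0.le
      push_cast
      have hnA : 0 ≤ n * A := by positivity
      have h3 : n * h = 20 * (n * A) + n * B := by rw [hh_def]; ring
      have h4 : 2200 * (A + B) * n = 2200 * (n * A) + 2200 * (n * B) := by ring
      rw [h4]
      linarith
    · refine (measureReal_poolWindow_gt_le hν hM1 Ic).trans ?_
      have e1 : Real.exp (-(2 * (n * (M : ℝ)⁻¹))) ≤ (n : ℝ)⁻¹ * (n : ℝ)⁻¹ := by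
        have h2 : Real.log n ≤ n * (M : ℝ)⁻¹ :=
          hnh.trans (mul_le_mul_of_nonneg_left hlow hn0.le)
        calc Real.exp (-(2 * (n * (M : ℝ)⁻¹))) ≤ Real.exp (-Real.log n + -Real.log n) :=
              Real.exp_le_exp.2 (by linarith)
          _ = (n : ℝ)⁻¹ * (n : ℝ)⁻¹ := by
              rw [Real.exp_add, Real.exp_neg, Real.exp_log hn0]
      -- The exponent is at most `Ic - 10 Ic log m`, and `Ic ≤ 2 Ic log m`, which leaves at least `8
      -- log m` of decay.
      have e2 : Real.exp (Ic - m * (M : ℝ)⁻¹ / 2) ≤ (m : ℝ)⁻¹ * (m : ℝ)⁻¹ := by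
        have h2 : 20 * (Ic * Real.log m) ≤ m * (M : ℝ)⁻¹ :=
          hmh.trans (mul_le_mul_of_nonneg_left hlow hm0.le)
        calc Real.exp (Ic - m * (M : ℝ)⁻¹ / 2) ≤ Real.exp (-Real.log m + -Real.log m) := by
              refine Real.exp_le_exp.2 ?_
              linarith
          _ = (m : ℝ)⁻¹ * (m : ℝ)⁻¹ := by
              rw [Real.exp_add, Real.exp_neg, Real.exp_log hm0]
      have f1 : (M : ℝ) ≤ 2 * n := le_of_mul_le_mul_right (by linarith) hh0
      have f2 : (M : ℝ) ≤ m := le_of_mul_le_mul_right (by linarith) hh0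
      have g1 : (M : ℝ) * ((n : ℝ)⁻¹ * (n : ℝ)⁻¹) ≤ 4 * B := by
        calc (M : ℝ) * ((n : ℝ)⁻¹ * (n : ℝ)⁻¹) ≤ 2 * n * ((n : ℝ)⁻¹ * (n : ℝ)⁻¹) := by gcongr
          _ = 2 / n := by field_simp
          _ ≤ 4 * B := by
            rw [div_le_iff₀ hn0]; linarith
      have g2 : (M : ℝ) * ((m : ℝ)⁻¹ * (m : ℝ)⁻¹) ≤ 4 * A := by
        calc (M : ℝ) * ((m : ℝ)⁻¹ * (m : ℝ)⁻¹) ≤ m * ((m : ℝ)⁻¹ * (m : ℝ)⁻¹) := by gcongr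
          _ = 1 / m := by field_simp
          _ ≤ 4 * A := by
            rw [div_le_iff₀ hm0]; linarith
      have g3 := mul_le_mul_of_nonneg_left (add_le_add e1 e2) hM0.le
      rw [mul_add] at g3
      linarith

end

end SCOP

/-! ### Stability on the product space and the final constants -/

namespace SCOP

noncomputable section

variable {n m : ℕ}

/-- The level after the `j`-th test score and the `k`-th calibration score have been replaced. -/
def pairLevel (κ : (Fin n ⊕ Fin m → ℝ) → ℕ) (tu tc : ℝ) (j : Fin m) (k : Fin n)
    (T : Fin n ⊕ Fin m → ℝ) : ℕ :=
  κ (Function.update (Function.update T (Sum.inr j) tu) (Sum.inl k) tc)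

lemma measurable_pairLevel {κ : (Fin n ⊕ Fin m → ℝ) → ℕ} (hκ : Measurable κ) (tu tc : ℝ)
    (j : Fin m) (k : Fin n) : Measurable (pairLevel κ tu tc j k) := by
  refine hκ.comp (measurable_pi_lambda _ fun i => ?_)
  by_cases h : i = Sum.inl k
  · subst h; simp
  · simp only [Function.update_of_ne h]
    by_cases h' : i = Sum.inr j
    · subst h'; simp
    · simpa [Function.update_of_ne h'] using measurable_pi_apply i

/-- Both exchanged coordinates are overwritten, so the exchange is invisible. This common value
links the leave-one-out levels before and after the exchange. -/
lemma pairLevel_comp_exch (κ : (Fin n ⊕ Fin m → ℝ) → ℕ) (tu tc : ℝ) (j : Fin m) (k : Fin n)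
    (T : Fin n ⊕ Fin m → ℝ) : pairLevel κ tu tc j k (T ∘ exch k j) = pairLevel κ tu tc j k T := by
  unfold pairLevel
  congr 1
  funext i
  by_cases h : i = Sum.inl k
  · subst h; simp
  · by_cases h' : i = Sum.inr j
    · subst h'; simp
    · simp [Function.update_of_ne h, Function.update_of_ne h', Equiv.swap_apply_of_ne_of_ne h h']

/-- The scores satisfying the stability inequalities. -/
def stableScores (κ : (Fin n ⊕ Fin m → ℝ) → ℕ) (tu tc : ℝ) (Iu Ic k₀ : ℕ) :
    Set (Fin n ⊕ Fin m → ℝ) :=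
  {T | (∀ j : Fin m, (testRank T (Sum.inr j) < κ T → looLevel κ tu j T = κ T) ∧
      (κ T ≤ testRank T (Sum.inr j) →
        κ T ≤ looLevel κ tu j T ∧ looLevel κ tu j T ≤ κ T + Iu) ∧
      ∀ k : Fin n, looLevel κ tu j T ≤ pairLevel κ tu tc j k T ∧
        pairLevel κ tu tc j k T ≤ looLevel κ tu j T + Ic) ∧ k₀ ≤ κ T ∧ κ T + 1 ≤ m}

lemma measurableSet_stableScores {κ : (Fin n ⊕ Fin m → ℝ) → ℕ} (hκ : Measurable κ) (tu tc : ℝ)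
    (Iu Ic k₀ : ℕ) : MeasurableSet (stableScores κ tu tc Iu Ic k₀) := by
  have hr : ∀ i, Measurable fun T : Fin n ⊕ Fin m → ℝ => testRank T i := fun i =>
    measurable_testRank measurable_id i
  have ha := fun j => measurable_looLevel hκ tu j
  have hp := fun j k => measurable_pairLevel hκ tu tc j k
  have heq : stableScores κ tu tc Iu Ic k₀ =
      (⋂ j : Fin m, ({T | testRank T (Sum.inr j) < κ T}ᶜ ∪ {T | looLevel κ tu j T = κ T}) ∩
        (({T | κ T ≤ testRank T (Sum.inr j)}ᶜ ∪
          ({T | κ T ≤ looLevel κ tu j T} ∩ {T | looLevel κ tu j T ≤ κ T + Iu})) ∩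
        ⋂ k : Fin n, {T | looLevel κ tu j T ≤ pairLevel κ tu tc j k T} ∩
          {T | pairLevel κ tu tc j k T ≤ looLevel κ tu j T + Ic})) ∩
      ({T | k₀ ≤ κ T} ∩ {T | κ T + 1 ≤ m}) := by
    ext T
    simp only [stableScores, mem_ofPred_eq, mem_inter_iff, mem_iInter, mem_union, mem_compl_iff,
      imp_iff_not_or]
  rw [heq]
  refine (MeasurableSet.iInter fun j => ?_).inter
    ((measurableSet_le measurable_const hκ).inter
      (measurableSet_le (hκ.add_const 1) measurable_const))
  refine ((measurableSet_lt (hr _) hκ).compl.union (measurableSet_eq_fun (ha j) hκ)).inter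
    (((measurableSet_le hκ (hr _)).compl.union ((measurableSet_le hκ (ha j)).inter
      (measurableSet_le (ha j) (hκ.add_const Iu)))).inter (MeasurableSet.iInter fun k => ?_))
  exact (measurableSet_le (ha j) (hp j k)).inter
    (measurableSet_le (hp j k) ((ha j).add_const Ic))

/-- The bound on the mean false coverage proportion on the product space. -/
theorem abs_integral_rankFCP_sub_le_of_stable {ν : Measure (ℝ × ℝ)} [IsProbabilityMeasure ν]
    (hν₁ : ∀ c, ν {x | x.1 = c} = 0) (hν₂ : ∀ c, ν {x | x.2 = c} = 0) {α γ ρ : ℝ}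
    (hα : α ∈ Ioo (0 : ℝ) 1) (hγ : γ ∈ Ioo (0 : ℝ) 1) (hρ : ρ ∈ Ioo (0 : ℝ) 1)
    {κ : (Fin n ⊕ Fin m → ℝ) → ℕ} (hκ : Measurable κ) {tu tc : ℝ} {Iu Ic : ℕ}
    (hstable : ∀ᵐ z ∂(sampleLaw n m ν), snds z ∈ stableScores κ tu tc Iu Ic ⌈γ * (m : ℝ)⌉₊)
    (hn : 2 ≤ n) (hmγ : 32 * Real.log m ≤ m * γ) :
    |∫ z, rankFCP α κ (fsts z) (snds z) ∂(sampleLaw n m ν) - α| ≤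
      10000 * (1 / (ρ * γ ^ 3) * (Ic * Real.log m / m + Real.log n / n) +
        Iu * Real.log m / (m * γ)) := by
  have hγ0 := hγ.1
  have hγ1 := hγ.2
  have hρ0 := hρ.1
  have hρ1 := hρ.2
  have hn' : (2 : ℝ) ≤ n := by exact_mod_cast hn
  have hn0 : (0 : ℝ) < n := by linarith
  set k₀ : ℕ := ⌈γ * (m : ℝ)⌉₊ with hk₀_def
  -- An almost sure event is nonempty, so `⌈γ m⌉ ≤ κ ≤ m - 1` holds for some score vector, which
  -- rules out `m = 0` and `m = 1`.
  have hm : 2 ≤ m := by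
    obtain ⟨z, hz⟩ := hstable.exists
    have h1 := hz.2.1
    have h2 := hz.2.2
    by_contra hlt
    have hm1 : m = 1 := by omega
    have : 0 < k₀ := Nat.ceil_pos.2 (by rw [hm1]; simpa using hγ0)
    omega
  have hm' : (2 : ℝ) ≤ m := by exact_mod_cast hm
  have hm0 : (0 : ℝ) < m := by linarith
  have hlm := half_le_log hm'
  have hln := half_le_log hn'
  have hk₀γ : γ * m ≤ k₀ := Nat.le_ceil _
  have hk₀2 : 2 ≤ k₀ := by
    have : (2 : ℝ) ≤ k₀ := by linarith
    exact_mod_cast this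
  have hk₀pos : 0 < k₀ := by omega
  have hk₀2' : (2 : ℝ) ≤ k₀ := by exact_mod_cast hk₀2
  have hk₀m : k₀ ≤ m := by
    obtain ⟨z, hz⟩ := hstable.exists
    have h1 := hz.2.1
    have h2 := hz.2.2
    omega
  have hk₀m' : (k₀ : ℝ) ≤ m := by exact_mod_cast hk₀m
  set A : ℝ := Ic * Real.log m / m with hA
  set B : ℝ := Real.log n / n with hB
  have hA0 : 0 ≤ A := by positivity
  have hB0 : 0 ≤ B := by positivity
  set U : ℝ := Iu * Real.log m / (m * γ) with hU
  have hU0 : 0 ≤ U := by positivity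
  have hρ_inv : (γ ^ 2)⁻¹ ≤ 1 / (ρ * γ ^ 3) := by
    rw [← one_div]
    refine one_div_le_one_div_of_le (by positivity) ?_
    have : ρ * γ ≤ 1 := by nlinarith
    nlinarith [sq_nonneg γ]
  have hγinv : 1 ≤ γ⁻¹ := (one_le_inv₀ hγ0).2 hγ1.le
  have hγsq : (γ ^ 2)⁻¹ = γ⁻¹ * γ⁻¹ := by rw [sq, mul_inv]
  have hγsq1 : 1 ≤ (γ ^ 2)⁻¹ := by rw [hγsq]; nlinarith
  -- The argument yields the factor `γ⁻²`, which is at most `1 / (ρ γ ^ 3)` since `ρ γ ≤ 1`.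
  suffices h : |∫ z, rankFCP α κ (fsts z) (snds z) ∂(sampleLaw n m ν) - α| ≤
      10000 * ((γ ^ 2)⁻¹ * (A + B) + U) by
    refine h.trans (mul_le_mul_of_nonneg_left ?_ (by norm_num))
    gcongr
  -- If `A + B ≥ 1/20` the claim is trivial, both the mean and `α` lying in `[0, 1]`.
  rcases le_or_gt 1 (20 * (A + B)) with hbig | hsmall
  · have h0 : 0 ≤ ∫ z, rankFCP α κ (fsts z) (snds z) ∂(sampleLaw n m ν) :=
      integral_nonneg fun z => (rankFCP_mem_Icc α κ _ _).1
    have h1 : ∫ z, rankFCP α κ (fsts z) (snds z) ∂(sampleLaw n m ν) ≤ 1 := by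
      have h := norm_integral_le_of_norm_le_const (μ := sampleLaw n m ν) (C := 1)
        (f := fun z => rankFCP α κ (fsts z) (snds z)) (Filter.Eventually.of_forall fun z => by
          have := rankFCP_mem_Icc α κ (fsts z) (snds z)
          rw [Real.norm_of_nonneg this.1]; exact this.2)
      rw [probReal_univ, mul_one] at h
      exact (le_abs_self _).trans h
    have h2 : |∫ z, rankFCP α κ (fsts z) (snds z) ∂(sampleLaw n m ν) - α| ≤ 1 := by
      rw [abs_le]
      constructor <;> linarith [hα.1, hα.2]
    have h3 : A + B ≤ (γ ^ 2)⁻¹ * (A + B) := le_mul_of_one_le_left (by linarith) hγsq1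
    linarith
  · obtain ⟨D, hD1, hD2⟩ := exists_poolWindow_bound hν₂ hn hm hsmall
    have hinjR := ae_injective_comp (n := n) (m := m) measurable_fst hν₁
    have hinjT := ae_injective_comp (n := n) (m := m) measurable_snd hν₂
    have hpair : ∀ᵐ z ∂(sampleLaw n m ν), ∀ (j : Fin m) (k : Fin n),
        looLevel κ tu j (snds z) ≤ looLevel κ tu j (snds z ∘ exch k j) + Ic ∧
        looLevel κ tu j (snds z ∘ exch k j) ≤ looLevel κ tu j (snds z) + Ic := by
      have hσ : ∀ᵐ z ∂(sampleLaw n m ν), ∀ (j : Fin m) (k : Fin n),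
          snds z ∘ exch k j ∈ stableScores κ tu tc Iu Ic k₀ := by
        rw [ae_all_iff]
        intro j
        rw [ae_all_iff]
        intro k
        exact ae_comp_perm ν (exch k j) hstable
      -- With `p` the doubly overwritten level, `a ≤ p ≤ a + Ic` and `b ≤ p ≤ b + Ic`, so the levels
      -- differ by at most `Ic`.
      filter_upwards [hstable, hσ] with z h1 h2 j k
      have e1 := (h1.1 j).2.2 k
      have e2 := ((h2 j k).1 j).2.2 k
      rw [pairLevel_comp_exch] at e2
      omega
    have hmain := abs_integral_rankFCP_sub_le hα hκ (tu := tu) (Iu := Iu) (Ic := Ic) (D := D)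
      hk₀pos hinjR hinjT
      (by filter_upwards [hstable] with z hz; exact ⟨hz.2.1, by have := hz.2.2; omega⟩)
      (by filter_upwards [hstable] with z hz j; exact (hz.1 j).1)
      (by filter_upwards [hstable] with z hz j; exact (hz.1 j).2.1) hpair
    refine hmain.trans ?_
    set I : ℝ := ∫ z, ((calBelow k₀ (snds z) : ℝ) + 1)⁻¹ ∂(sampleLaw n m ν) with hI
    set p : ℝ := (sampleLaw n m ν).real {z | ∀ (j : Fin m) (x : ℕ),
            poolWindow j (snds z) Ic x ≤ D}ᶜ with hp
    have hI0 : 0 ≤ I := integral_nonneg fun z => by positivity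
    have hIle : k₀ * (n * I) ≤ 4 * m := by
      -- Taken at `r = k₀ - 1`, so that ranks below `k₀` are counted; `k₀ ≥ 2` gives `k₀ - 1 ≥ k₀ /
      -- 2`, which costs a factor 2.
      have h := integral_inv_calBelow_le (n := n) (m := m) hinjT (r := k₀ - 1) (by omega)
      rw [Nat.sub_add_cancel (by omega), Nat.cast_sub (by omega), Nat.cast_one, ← hI] at h
      have h1 : (k₀ : ℝ) / 2 * (n * I) ≤ (k₀ - 1) * ((n + 1) * I) := by
        refine mul_le_mul (by linarith) (mul_le_mul_of_nonneg_right (by linarith) hI0)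
          (by positivity) (by linarith)
      linarith
    have hkinv : (k₀ : ℝ)⁻¹ ≤ γ⁻¹ * (m : ℝ)⁻¹ := by
      rw [← mul_inv]
      exact inv_anti₀ (by positivity) hk₀γ
    have hk₀0 : (0 : ℝ) < k₀ := by linarith
    have hmk : m * (k₀ : ℝ)⁻¹ ≤ γ⁻¹ := by
      calc m * (k₀ : ℝ)⁻¹ ≤ m * (γ⁻¹ * (m : ℝ)⁻¹) := by gcongr
        _ = γ⁻¹ := by field_simp
    have hnI : n * I ≤ 4 * γ⁻¹ := by
      calc n * I = (k₀ : ℝ)⁻¹ * (k₀ * (n * I)) := by field_simp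
        _ ≤ (k₀ : ℝ)⁻¹ * (4 * m) := by gcongr
        _ = 4 * (m * (k₀ : ℝ)⁻¹) := by ring
        _ ≤ 4 * γ⁻¹ := by gcongr
    have hDI : (1 + 6 * (D : ℝ)) * I ≤ 8800 * (γ⁻¹ * (A + B)) := by
      calc (1 + 6 * (D : ℝ)) * I = (1 + 6 * (D : ℝ)) / n * (n * I) := by field_simp
        _ ≤ 2200 * (A + B) * (4 * γ⁻¹) := by gcongr
        _ = 8800 * (γ⁻¹ * (A + B)) := by ring
    have hIcm : Ic * (m : ℝ)⁻¹ ≤ 2 * A := by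
      rw [hA, mul_div_assoc, div_eq_mul_inv, mul_left_comm]
      have : (Ic : ℝ) * (m : ℝ)⁻¹ * 1 ≤ Ic * (m : ℝ)⁻¹ * (2 * Real.log m) := by
        gcongr; linarith
      linarith
    have hIck : Ic * (k₀ : ℝ)⁻¹ ≤ 2 * (γ⁻¹ * (A + B)) := by
      calc Ic * (k₀ : ℝ)⁻¹ ≤ Ic * (γ⁻¹ * (m : ℝ)⁻¹) := by gcongr
        _ = γ⁻¹ * (Ic * (m : ℝ)⁻¹) := by ring
        _ ≤ γ⁻¹ * (2 * A) := by gcongr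
        _ ≤ γ⁻¹ * (2 * (A + B)) := by gcongr; linarith
        _ = 2 * (γ⁻¹ * (A + B)) := by ring
    have hIuk : Iu * (k₀ : ℝ)⁻¹ ≤ 2 * U := by
      calc Iu * (k₀ : ℝ)⁻¹ ≤ Iu * (γ⁻¹ * (m : ℝ)⁻¹) := by gcongr
        _ = Iu * (γ⁻¹ * (m : ℝ)⁻¹) * 1 := by ring
        _ ≤ Iu * (γ⁻¹ * (m : ℝ)⁻¹) * (2 * Real.log m) := by gcongr; linarith
        _ = 2 * U := by rw [hU]; field_simp
    set W := γ⁻¹ * (A + B) with hW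
    have hAW : A + B ≤ W := le_mul_of_one_le_left (by linarith) hγinv
    have hW0 : 0 ≤ W := by linarith
    have hWW : W ≤ γ⁻¹ * W := le_mul_of_one_le_left hW0 hγinv
    have hp0 : 0 ≤ p := measureReal_nonneg
    -- The bracket is at most `8800 W + 4 W + 16 W`: the inverse moment, the change of level, and
    -- the exceptional event.
    have hbr : m * (k₀ : ℝ)⁻¹ * ((1 + 6 * D) * I + 2 * Ic * (k₀ : ℝ)⁻¹ + 4 * p) ≤
        γ⁻¹ * (9000 * W) := by
      refine mul_le_mul hmk (by linarith) (by positivity) (by positivity)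
    have hfin : (γ ^ 2)⁻¹ * (A + B) = γ⁻¹ * W := by rw [hγsq, hW]; ring
    rw [hfin]
    linarith

end

end SCOP

/-! ### Transfer from the probability space to the product law -/

theorem theorem3 :
    ∃ C : ℝ, 0 < C ∧
      ∀ (Ω : Type*) [MeasurableSpace Ω] (P : Measure Ω) [IsProbabilityMeasure P]
        (d n m : ℕ)
        (X : Fin n ⊕ Fin m → Ω → EuclideanSpace ℝ (Fin d)) (Y : Fin n ⊕ Fin m → Ω → ℝ)
        (g f : EuclideanSpace ℝ (Fin d) → ℝ)
        (κ : (Fin n ⊕ Fin m → ℝ) → ℕ)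
        (α γ ρ tu tc : ℝ) (Iu Ic : ℕ),
        (∀ i, Measurable (X i)) → (∀ i, Measurable (Y i)) →
        Measurable g → Measurable f → Measurable κ →
        α ∈ Ioo (0 : ℝ) 1 → γ ∈ Ioo (0 : ℝ) 1 → ρ ∈ Ioo (0 : ℝ) 1 →
        SCOP.IIDContinuous P
          (fun i ω => SCOP.residual f (fun l => X l ω) (fun l => Y l ω) i)
          (fun i ω => SCOP.score g (fun l => X l ω) i) →
        SCOP.StableRanking P κ (fun i ω => SCOP.score g (fun l => X l ω) i) γ tu tc Iu Ic →
        (∀ i, SCOP.JointCDFLowerBound P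
          (fun ω => SCOP.residual f (fun l => X l ω) (fun l => Y l ω) i)
          (fun ω => SCOP.score g (fun l => X l ω) i) γ ρ) →
        2 ≤ n →
        256 * Real.log n ≤ n * γ →
        32 * Real.log m ≤ m * γ →
        |SCOP.FCR P α κ g f X Y - α| ≤
          C * (1 / (ρ * γ ^ 3) * (Ic * Real.log m / m + Real.log n / n) +
            Iu * Real.log m / (m * γ)) := by
  refine ⟨10000, by norm_num, ?_⟩
  intro Ω _ P _ d n m X Y g f κ α γ ρ tu tc Iu Ic hX hY hg hf hκ hα hγ hρ hiid hst _ hn _ hmγ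
  set R : Fin n ⊕ Fin m → Ω → ℝ :=
    fun i ω => SCOP.residual f (fun l => X l ω) (fun l => Y l ω) i with hR
  set T : Fin n ⊕ Fin m → Ω → ℝ := fun i ω => SCOP.score g (fun l => X l ω) i with hT
  have hRm : ∀ i, Measurable (R i) := fun i => ((hY i).sub (hf.comp (hX i))).abs
  have hTm : ∀ i, Measurable (T i) := fun i => hg.comp (hX i)
  have hZm : ∀ i, Measurable fun ω => (R i ω, T i ω) := fun i => (hRm i).prodMk (hTm i)
  set i₀ : Fin n ⊕ Fin m := Sum.inl ⟨0, by omega⟩ with hi₀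
  set ν : Measure (ℝ × ℝ) := P.map fun ω => (R i₀ ω, T i₀ ω) with hν
  have hprob : IsProbabilityMeasure ν := Measure.isProbabilityMeasure_map (hZm i₀).aemeasurable
  set Z : Ω → Fin n ⊕ Fin m → ℝ × ℝ := fun ω i => (R i ω, T i ω) with hZ
  have hZmeas : Measurable Z := measurable_pi_lambda _ hZm
  -- By independence and equality in law, the joint law of the pairs is the product measure, on
  -- which exchanges are measure preserving. Both the rate and the stability conditions depend on
  -- the data only through these pairs.
  have hmap : P.map Z = SCOP.sampleLaw n m ν := by
    have h := (iIndepFun_iff_map_fun_eq_pi_map fun i => (hZm i).aemeasurable).1 hiid.indep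
    have h2 : (fun i => P.map fun ω => (R i ω, T i ω)) = fun _ => ν := by
      funext i
      exact (hiid.identDistrib i i₀).map_eq
    rw [hZ, h, h2]
  have hν₁ : ∀ c, ν {x | x.1 = c} = 0 := by
    intro c
    rw [hν, Measure.map_apply (hZm i₀) (measurableSet_eq_fun measurable_fst measurable_const)]
    exact hiid.noAtoms_R i₀ c
  have hν₂ : ∀ c, ν {x | x.2 = c} = 0 := by
    intro c
    rw [hν, Measure.map_apply (hZm i₀) (measurableSet_eq_fun measurable_snd measurable_const)]
    exact hiid.noAtoms_T i₀ c
  have hstable : ∀ᵐ z ∂(SCOP.sampleLaw n m ν),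
      SCOP.snds z ∈ SCOP.stableScores κ tu tc Iu Ic ⌈γ * (m : ℝ)⌉₊ := by
    have hms : MeasurableSet {z : Fin n ⊕ Fin m → ℝ × ℝ |
        SCOP.snds z ∈ SCOP.stableScores κ tu tc Iu Ic ⌈γ * (m : ℝ)⌉₊} :=
      SCOP.measurable_snds (SCOP.measurableSet_stableScores hκ tu tc Iu Ic _)
    rw [← hmap, ae_map_iff hZmeas.aemeasurable hms]
    filter_upwards [hst.selected, hst.unselected, hst.pair, hst.range] with ω h1 h2 h3 h4
    refine ⟨fun j => ⟨fun hj => h1 j ?_, fun hj => h2 j ?_, fun k => h3 j k⟩, h4⟩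
    · rw [SCOP.mem_selectedTest_iff]
      exact hj
    · rw [SCOP.mem_selectedTest_iff]
      exact not_lt.2 hj
  have hFCR : SCOP.FCR P α κ g f X Y =
      ∫ z, SCOP.rankFCP α κ (SCOP.fsts z) (SCOP.snds z) ∂(SCOP.sampleLaw n m ν) := by
    rw [← hmap, integral_map hZmeas.aemeasurable (SCOP.measurable_rankFCP α hκ
      SCOP.measurable_fsts SCOP.measurable_snds).aestronglyMeasurable]
    unfold SCOP.FCR
    simp only [SCOP.falseCoverageProportion_eq]
    rfl
  rw [hFCR]
  exact SCOP.abs_integral_rankFCP_sub_le_of_stable hν₁ hν₂ hα hγ hρ hκ hstable hn hmγ
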